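/- Let $(X,\omega)$ be a compact Kähler manifold of dimension $n$ with volume $V=\int_X \omega^n/n!$, and let $E$ be a globally generated (for instance, very ample) holomorphic vector bundle of rank $r$ on $X$. Let $H^0(X,E)$ be its space of holomorphic sections, $N=\dim H^0(X,E)$, let $K$ be the set of smooth Hermitian metrics on $E$ and $M$ the set of Hermitian inner products on $H^0(X,E)$. Define: - $\mathrm{Hilb}:K\to M$ by $\langle s,t\rangle_{\mathrm{Hilb}(h)}=\frac{N}{Vr}\int_X h(s,t)\,\frac{\omega^n}{n!}$; - $FS:M\to K$, where $FS(H)$ is the unique metric $h\in K$ with $\sum_i s_i\otimes s_i^{*_h}=\mathrm{Id}_E$ for every $H$-orthonormal basis $s_1,\dots,s_N$ of $H^0(X,E)$; - $T=\mathrm{Hilb}\circ FS:M\to M$; - $I:K\to\mathbb R$, the functional with $\frac{d}{dt}I(e^{\varphi_t}h_0)=\int_X \mathrm{tr}(\dot\varphi_t)\,\frac{\omega^n}{n!}$, normalized by $I(h_0)=0$ for a fixed (arbitrary) $h_0\in K$, that is $I(h)=\int_X\log\det(h_0^{-1}h)\,\frac{\omega^n}{n!}$; - $Z=-I\circ FS$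 and $\widetilde Z(H)=Z(H)+\frac{rV}{N}\log\det H$, where $\det H$ is the determinant of $[H(\theta_i,\theta_j)]$ in a fixed (arbitrary) basis $\theta_1,\dots,\theta_N$ of $H^0(X,E)$. Fix a basis $b_1,\dots,b_N$ of $H^0(X,E)$. A set $U\subseteq M$ is called bounded (in the sense of Sano) if there is $R>1$ such that for every $H\in U$ there is $\gamma_H>0$ with $$\frac{\gamma_H}{R}\le \min_{\xi\ne0}\frac{|H(\xi)|}{|\xi|}\le\max_{\xi\neq0}\frac{|H(\xi)|}{|\xi|}\le\gamma_H R,$$ where $H$ acts on $\xi\in\mathbb C^N$ through the matrix $[H(b_i,b_j)]$. Let $H_0\in M$ and $H_k=T^k(H_0)$ for $k\ge 0$. If the set $\{H_k: k\ge 0\}$ is bounded, then: 1. for every $H\in M$ and every $\varepsilon>0$, $\ \widetilde Z(H)>\widetilde Z(H_k)-\varepsilon$ for all sufficiently large $k$; 2. $\widetilde Z$ is bounded below on $M$, and $\widetilde Z(H_k)\to\inf\{\widetilde Z(H): H\in M\}$ as $k\to\infty$. -/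

import Mathlib

open Set Filter Bundle MeasureTheory
open scoped Manifold ContDiff Topology ComplexConjugate

set_option linter.unusedSectionVars false

noncomputable section
namespace BalancedMetric

variable {n r : ℕ} {X : Type*} [TopologicalSpace X] [ChartedSpace (Fin n → ℂ) X]

section Bundle
variable (n r) (E : X → Type*)
  [TopologicalSpace (TotalSpace (Fin r → ℂ) E)] [∀ x, TopologicalSpace (E x)]
  [∀ x, AddCommGroup (E x)] [∀ x, Module ℂ (E x)]
  [FiberBundle (Fin r → ℂ) E] [VectorBundle ℂ (Fin r → ℂ) E]

/-- The space `H⁰(X, E)` of holomorphic sections of the holomorphic vector bundle `E` of rank `r`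
over the complex manifold `X` of dimension `n`. -/
abbrev HolSection : Type _ := ContMDiffSection 𝓘(ℂ, Fin n → ℂ) (Fin r → ℂ) ω E

/-- `E` is globally generated: the evaluation maps `H⁰(X, E) → Eₓ` are all surjective. -/
def IsGloballyGenerated : Prop := ∀ (x : X) (v : E x), ∃ s : HolSection n r E, s x = v

/-- Smooth Hermitian metrics on the complex vector bundle `E`: a positive definite Hermitian inner
product on each fibre (conjugate-linear in the first variable), whose coefficients in the local
frames given by the trivializations of `E` are `C^∞` in the real sense. -/
structure HermitianMetric where
  form : ∀ x : X, InnerProductSpace.Core ℂ (E x)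
  smooth : ∀ (x₀ : X) (v w : Fin r → ℂ),
    ContMDiffOn 𝓘(ℝ, Fin n → ℂ) 𝓘(ℝ, ℂ) ∞
      (fun x => (form x).inner ((trivializationAt (Fin r → ℂ) E x₀).symmL ℂ x v)
        ((trivializationAt (Fin r → ℂ) E x₀).symmL ℂ x w))
      (trivializationAt (Fin r → ℂ) E x₀).baseSet

variable {n r E}

/-- The Gram matrix `h(eᵢ, eⱼ)` at `x` of the local frame of `E` given by the preferred
trivialization at `x₀`. -/
def HermitianMetric.gram (h : HermitianMetric n r E) (x₀ x : X) : Matrix (Fin r) (Fin r) ℂ :=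
  Matrix.of fun i j =>
    (h.form x).inner ((trivializationAt (Fin r → ℂ) E x₀).symmL ℂ x (Pi.single i 1))
      ((trivializationAt (Fin r → ℂ) E x₀).symmL ℂ x (Pi.single j 1))

end Bundle

section FiniteDim
variable {E : X → Type*}
  [TopologicalSpace (TotalSpace (Fin r → ℂ) E)] [∀ x, TopologicalSpace (E x)]
  [∀ x, AddCommGroup (E x)] [∀ x, Module ℂ (E x)]
  [FiberBundle (Fin r → ℂ) E] [VectorBundle ℂ (Fin r → ℂ) E]
  [IsManifold 𝓘(ℂ, Fin n → ℂ) ω X]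
  [ContMDiffVectorBundle ω (Fin r → ℂ) E 𝓘(ℂ, Fin n → ℂ)]

theorem HolSection.contMDiffOn_coord (s : HolSection n r E) (x₀ : X) :
    ContMDiffOn 𝓘(ℂ, Fin n → ℂ) 𝓘(ℂ, Fin r → ℂ) ω
      (fun x => (trivializationAt (Fin r → ℂ) E x₀ ⟨x, s x⟩).2)
      (trivializationAt (Fin r → ℂ) E x₀).baseSet :=
  (Trivialization.contMDiffOn_section_baseSet_iff (IB := 𝓘(ℂ, Fin n → ℂ)) (n := ω)
    (trivializationAt (Fin r → ℂ) E x₀)).1 s.contMDiff.contMDiffOn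

theorem HolSection.differentiableOn_coord (s : HolSection n r E) (x₀ : X) :
    DifferentiableOn ℂ
      (fun z => (trivializationAt (Fin r → ℂ) E x₀
        ⟨(chartAt (Fin n → ℂ) x₀).symm z, s ((chartAt (Fin n → ℂ) x₀).symm z)⟩).2)
      ((chartAt (Fin n → ℂ) x₀).target ∩
        (chartAt (Fin n → ℂ) x₀).symm ⁻¹' (trivializationAt (Fin r → ℂ) E x₀).baseSet) := by
  have h1 := s.contMDiffOn_coord x₀
  have h2 : ContMDiffOn 𝓘(ℂ, Fin n → ℂ) 𝓘(ℂ, Fin n → ℂ) ω (chartAt (Fin n → ℂ) x₀).symm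
      (chartAt (Fin n → ℂ) x₀).target := contMDiffOn_chart_symm (I := 𝓘(ℂ, Fin n → ℂ))
  have h3 := h1.comp (h2.mono inter_subset_left)
    (fun z (hz : z ∈ (chartAt (Fin n → ℂ) x₀).target ∩ (chartAt (Fin n → ℂ) x₀).symm ⁻¹'
      (trivializationAt (Fin r → ℂ) E x₀).baseSet) => hz.2)
  exact (contMDiffOn_iff_contDiffOn.1 h3).differentiableOn (by simp)

variable (n r E) in
theorem HolSection.exists_finite_determining [CompactSpace X] [T2Space X] :
    ∃ P : Set X, P.Finite ∧ ∀ s : HolSection n r E, (∀ p ∈ P, s p = 0) → s = 0 := by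
  let φ : ∀ x₀ : X, OpenPartialHomeomorph X (Fin n → ℂ) := fun x₀ => chartAt (Fin n → ℂ) x₀
  let e := fun x₀ : X => trivializationAt (Fin r → ℂ) E x₀
  let f : X → HolSection n r E → (Fin n → ℂ) → (Fin r → ℂ) := fun x₀ s z =>
    (e x₀ ⟨(φ x₀).symm z, s ((φ x₀).symm z)⟩).2
  have hU : ∀ x₀ : X, IsOpen ((φ x₀).target ∩ (φ x₀).symm ⁻¹' (e x₀).baseSet) := fun x₀ =>
    (φ x₀).isOpen_inter_preimage_symm (e x₀).open_baseSet
  have hρ : ∀ x₀ : X, ∃ ρ : ℝ, 0 < ρ ∧ Metric.closedBall (φ x₀ x₀) (2 * ρ) ⊆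
      (φ x₀).target ∩ (φ x₀).symm ⁻¹' (e x₀).baseSet := by
    intro x₀
    have : (φ x₀).target ∩ (φ x₀).symm ⁻¹' (e x₀).baseSet ∈ 𝓝 (φ x₀ x₀) := by
      refine (hU x₀).mem_nhds ⟨mem_chart_target _ x₀, ?_⟩
      rw [mem_preimage, (φ x₀).left_inv (mem_chart_source _ x₀)]
      exact mem_baseSet_trivializationAt _ _ x₀
    obtain ⟨ε, hε, h⟩ := Metric.nhds_basis_closedBall.mem_iff.1 this
    exact ⟨ε / 2, by positivity, by rwa [mul_div_cancel₀ _ two_ne_zero]⟩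
  choose ρ hρ0 hρ using hρ
  obtain ⟨t, ht⟩ := CompactSpace.elim_nhds_subcover
    (fun x₀ : X => (φ x₀).source ∩ φ x₀ ⁻¹' Metric.ball (φ x₀ x₀) (ρ x₀)) (fun x₀ => by
      refine ((φ x₀).isOpen_inter_preimage Metric.isOpen_ball).mem_nhds
        ⟨mem_chart_source _ x₀, ?_⟩
      exact Metric.mem_ball_self (hρ0 x₀))
  -- compact pieces and a bound for the transition maps
  let K : X → Set X := fun x₀ => (φ x₀).symm '' Metric.closedBall (φ x₀ x₀) (2 * ρ x₀)
  have hK : ∀ x₀, IsCompact (K x₀) := fun x₀ =>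
    (isCompact_closedBall _ _).image_of_continuousOn
      ((φ x₀).continuousOn_symm.mono fun z hz => (hρ x₀ hz).1)
  have hKe : ∀ x₀, K x₀ ⊆ (e x₀).baseSet := by
    rintro x₀ _ ⟨z, hz, rfl⟩
    exact (hρ x₀ hz).2
  have hKc : ∀ x₀, K x₀ ⊆ (φ x₀).source := by
    rintro x₀ _ ⟨z, hz, rfl⟩
    exact (φ x₀).map_target (hρ x₀ hz).1
  have hC : ∀ i j : X, ∃ C : ℝ, ∀ p ∈ K i ∩ K j,
      ‖((e i).coordChangeL ℂ (e j) p : (Fin r → ℂ) →L[ℂ] (Fin r → ℂ))‖ ≤ C := fun i j =>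
    ((hK i).inter (hK j)).exists_bound_of_continuousOn
      ((continuousOn_coordChange ℂ (e i) (e j)).mono (inter_subset_inter (hKe i) (hKe j)))
  choose C hC using hC
  let D : ℝ := 1 + ∑ i ∈ t, ∑ j ∈ t, |C i j|
  have hD0 : 0 < D := by positivity
  have hD : ∀ i ∈ t, ∀ j ∈ t, C i j ≤ D := by
    intro i hi j hj
    have h1 : |C i j| ≤ ∑ j ∈ t, |C i j| :=
      Finset.single_le_sum (f := fun j => |C i j|) (fun _ _ => abs_nonneg _) hj
    have h2 : ∑ j ∈ t, |C i j| ≤ ∑ i ∈ t, ∑ j ∈ t, |C i j| :=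
      Finset.single_le_sum (f := fun i => ∑ j ∈ t, |C i j|)
        (fun _ _ => Finset.sum_nonneg fun _ _ => abs_nonneg _) hi
    have := le_abs_self (C i j)
    simp only [D]; linarith
  -- nets
  have hnet : ∀ i : X, ∃ A : Set (Fin n → ℂ), A ⊆ Metric.closedBall (φ i i) (ρ i) ∧ A.Finite ∧
      Metric.closedBall (φ i i) (ρ i) ⊆ ⋃ a ∈ A, Metric.ball a (min (ρ i) (ρ i / (4 * D))) := by
    intro i
    have hδ : 0 < min (ρ i) (ρ i / (4 * D)) :=
      lt_min (hρ0 i) (div_pos (hρ0 i) (by positivity))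
    exact (isCompact_closedBall (φ i i) (ρ i)).finite_cover_balls hδ
  choose A hAs hAf hAc using hnet
  refine ⟨⋃ i ∈ t, (φ i).symm '' A i, ?_, ?_⟩
  · exact t.finite_toSet.biUnion fun i _ => (hAf i).image _
  intro s hs
  have hloc : ∀ x₀ p, p ∈ (φ x₀).source → f x₀ s (φ x₀ p) = (e x₀ ⟨p, s p⟩).2 := by
    intro x₀ p hp
    exact congrArg (fun q => (e x₀ ⟨q, s q⟩).2) ((φ x₀).left_inv hp)
  have hzero : ∀ i ∈ t, ∀ a ∈ A i, f i s a = 0 := by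
    intro i hi a ha
    have h0 : s ((φ i).symm a) = 0 := hs _ (mem_biUnion hi (mem_image_of_mem _ ha))
    have hb : (φ i).symm a ∈ (e i).baseSet :=
      (hρ i (Metric.closedBall_subset_closedBall (by linarith [hρ0 i]) (hAs i ha))).2
    simp only [f, h0]
    exact congrArg Prod.snd ((e i).zeroSection ℂ hb)
  have hdiff : ∀ i, DifferentiableOn ℂ (f i s) (Metric.closedBall (φ i i) (2 * ρ i)) := fun i =>
    (s.differentiableOn_coord i).mono (hρ i)
  have hstep : ∀ M : ℝ, (∀ i ∈ t, ∀ z ∈ Metric.closedBall (φ i i) (2 * ρ i), ‖f i s z‖ ≤ M) →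
      ∀ i ∈ t, ∀ z ∈ Metric.closedBall (φ i i) (2 * ρ i), ‖f i s z‖ ≤ M / 2 := by
    intro M hM j hj z hz
    have hM0 : 0 ≤ M := (norm_nonneg _).trans (hM j hj z hz)
    set p := (φ j).symm z with hp
    have hpj : p ∈ K j := mem_image_of_mem _ hz
    have hpx : p ∈ ⋃ x ∈ t, (φ x).source ∩ φ x ⁻¹' Metric.ball (φ x x) (ρ x) := by
      rw [ht]; trivial
    obtain ⟨i, hi, hpi, hpb⟩ := mem_iUnion₂.1 hpx
    have hpb' : φ i p ∈ Metric.closedBall (φ i i) (ρ i) := Metric.ball_subset_closedBall hpb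
    have hpKi : p ∈ K i :=
      ⟨φ i p, Metric.closedBall_subset_closedBall (by linarith [hρ0 i]) hpb', (φ i).left_inv hpi⟩
    -- estimate in the chart at `i`
    obtain ⟨a, ha, hda⟩ := mem_iUnion₂.1 (hAc i hpb')
    have hball : Metric.ball a (ρ i) ⊆ Metric.closedBall (φ i i) (2 * ρ i) := by
      intro y hy
      have h1 := Metric.mem_closedBall.1 (hAs i ha)
      have h2 := Metric.mem_ball.1 hy
      rw [Metric.mem_closedBall]
      linarith [dist_triangle y a (φ i i)]
    have hda' := Metric.mem_ball.1 hda
    have h1 := Complex.dist_le_div_mul_dist_of_mapsTo_ball (R₂ := M) ((hdiff i).mono hball)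
      (fun y hy => by
        rw [hzero i hi a ha, Metric.mem_closedBall, dist_zero_right]
        exact hM i hi y (hball hy))
      (Metric.mem_ball.2 (hda'.trans_le (min_le_left _ _)))
    rw [hzero i hi a ha, dist_zero_right] at h1
    have h2 : ‖f i s (φ i p)‖ ≤ M / (4 * D) := by
      refine h1.trans ?_
      have := (hda'.trans_le (min_le_right _ _)).le
      calc M / ρ i * dist (φ i p) a ≤ M / ρ i * (ρ i / (4 * D)) := by
            have := hρ0 i
            gcongr
        _ = M / (4 * D) := by have := (hρ0 i).ne'; field_simp
    -- transition
    have hbi := hKe i hpKi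
    have hbj := hKe j hpj
    have h3 : f j s z = (e i).coordChangeL ℂ (e j) p (f i s (φ i p)) := by
      rw [hloc i p hpi, Trivialization.coordChangeL_apply _ _ ⟨hbi, hbj⟩,
        Trivialization.symm_apply_apply_mk _ hbi]
    rw [h3]
    calc _ ≤ ‖((e i).coordChangeL ℂ (e j) p : (Fin r → ℂ) →L[ℂ] (Fin r → ℂ))‖ *
          ‖f i s (φ i p)‖ := ContinuousLinearMap.le_opNorm
            ((e i).coordChangeL ℂ (e j) p : (Fin r → ℂ) →L[ℂ] (Fin r → ℂ)) _
      _ ≤ D * (M / (4 * D)) := by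
          gcongr
          exact (hC i j p ⟨hpKi, hpj⟩).trans (hD i hi j hj)
      _ = M / 4 := by field_simp
      _ ≤ M / 2 := by linarith
  have hb : ∀ i, ∃ M : ℝ, ∀ z ∈ Metric.closedBall (φ i i) (2 * ρ i), ‖f i s z‖ ≤ M := fun i =>
    (isCompact_closedBall _ _).exists_bound_of_continuousOn (hdiff i).continuousOn
  choose M hM using hb
  have hiter : ∀ k : ℕ, ∀ i ∈ t, ∀ z ∈ Metric.closedBall (φ i i) (2 * ρ i),
      ‖f i s z‖ ≤ (∑ i ∈ t, |M i|) / 2 ^ k := by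
    intro k
    induction k with
    | zero =>
      intro i hi z hz
      have : |M i| ≤ ∑ i ∈ t, |M i| :=
        Finset.single_le_sum (f := fun i => |M i|) (fun _ _ => abs_nonneg _) hi
      simpa using ((hM i z hz).trans (le_abs_self _)).trans this
    | succ k ih =>
      rw [pow_succ, ← div_div]
      exact hstep _ ih
  ext x
  have hx : x ∈ ⋃ x ∈ t, (φ x).source ∩ φ x ⁻¹' Metric.ball (φ x x) (ρ x) := by
    rw [ht]; trivial
  obtain ⟨i, hi, hxi, hxb⟩ := mem_iUnion₂.1 hx
  have hxc : φ i x ∈ Metric.closedBall (φ i i) (2 * ρ i) :=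
    Metric.closedBall_subset_closedBall (by linarith [hρ0 i]) (Metric.ball_subset_closedBall hxb)
  have hlim : Tendsto (fun k : ℕ => (∑ i ∈ t, |M i|) / 2 ^ k) atTop (𝓝 0) := by
    have := (tendsto_pow_atTop_nhds_zero_of_lt_one (r := (1 / 2 : ℝ)) (by norm_num)
      (by norm_num)).const_mul (∑ i ∈ t, |M i|)
    simpa [div_eq_mul_inv] using this
  have hle : ‖f i s (φ i x)‖ ≤ 0 := ge_of_tendsto' hlim fun k => hiter k i hi _ hxc
  have h0 : (e i ⟨x, s x⟩).2 = 0 := by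
    rw [← hloc i x hxi]; exact norm_le_zero_iff.1 hle
  have hbx : x ∈ (e i).baseSet := hKe i ⟨φ i x, hxc, (φ i).left_inv hxi⟩
  have := (e i).symm_apply_apply_mk hbx (s x)
  rw [h0] at this
  rw [← this]
  exact ((e i).symmₗ_apply (R := ℂ) hbx 0).symm.trans (map_zero ((e i).symmₗ ℂ x))

/-- The space of holomorphic sections of a holomorphic vector bundle over a compact complex
manifold is finite-dimensional. -/
instance HolSection.finiteDimensional [CompactSpace X] [T2Space X] :
    FiniteDimensional ℂ (HolSection n r E) := by
  obtain ⟨P, hP, h⟩ := HolSection.exists_finite_determining n r E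
  have : Finite P := hP
  have hfin : ∀ x : X, Module.Finite ℂ (E x) := fun x =>
    Module.Finite.equiv ((trivializationAt (Fin r → ℂ) E x).linearEquivAt ℂ x
      (mem_baseSet_trivializationAt _ _ x)).symm
  let ev : HolSection n r E →ₗ[ℂ] (∀ p : P, E p) :=
    { toFun := fun s p => s p
      map_add' := fun _ _ => rfl
      map_smul' := fun _ _ => rfl }
  refine FiniteDimensional.of_injective ev ((injective_iff_map_eq_zero ev).2 fun s hs => ?_)
  exact h s fun p hp => congrFun hs ⟨p, hp⟩
end FiniteDim

section Parseval

theorem core_ext {W : Type*} [AddCommGroup W] [Module ℂ W] {c c' : InnerProductSpace.Core ℂ W}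
    (h : ∀ v w, c.inner v w = c'.inner v w) : c = c' := by
  obtain ⟨⟨⟨i⟩, _, _, _, _⟩, _⟩ := c
  obtain ⟨⟨⟨i'⟩, _, _, _, _⟩, _⟩ := c'
  have : i = i' := by
    funext v w
    exact h v w
  subst this
  rfl

section
variable {W : Type*} [AddCommGroup W] [Module ℂ W] (c : InnerProductSpace.Core ℂ W)

theorem core_add_right (u v w : W) : c.inner u (v + w) = c.inner u v + c.inner u w := by
  rw [← c.conj_inner_symm, c.add_left, map_add, c.conj_inner_symm, c.conj_inner_symm]

theorem core_smul_right (u v : W) (a : ℂ) : c.inner u (a • v) = a * c.inner u v := by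
  rw [← c.conj_inner_symm, c.smul_left, map_mul, c.conj_inner_symm, Complex.conj_conj]

/-- The sesquilinear form underlying a Hermitian inner product. -/
def coreForm : W →ₗ⋆[ℂ] W →ₗ[ℂ] ℂ :=
  LinearMap.mk₂'ₛₗ (starRingEnd ℂ) (RingHom.id ℂ) (fun v w => c.inner v w)
    (fun u v w => c.add_left u v w) (fun a v w => c.smul_left v w a)
    (fun u v w => core_add_right c u v w) (fun a v w => core_smul_right c v w a)

theorem coreForm_apply (v w : W) : coreForm c v w = c.inner v w := rfl

theorem core_sum_left {ι : Type*} (t : Finset ι) (f : ι → W) (w : W) :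
    c.inner (∑ i ∈ t, f i) w = ∑ i ∈ t, c.inner (f i) w := by
  simp only [← coreForm_apply, map_sum, LinearMap.sum_apply]

theorem core_sum_right {ι : Type*} (t : Finset ι) (f : ι → W) (w : W) :
    c.inner w (∑ i ∈ t, f i) = ∑ i ∈ t, c.inner w (f i) := by
  simp only [← coreForm_apply, map_sum]

end

/-- A finite spanning family `u` of a complex vector space is a Parseval frame for exactly one
Hermitian inner product. -/
theorem exists_unique_parseval {W ι : Type*} [AddCommGroup W] [Module ℂ W] [Fintype ι] (u : ι → W)
    (hu : Submodule.span ℂ (range u) = ⊤) :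
    ∃! c : InnerProductSpace.Core ℂ W, ∀ w, ∑ i, c.inner (u i) w • u i = w := by
  classical
  refine existsUnique_of_exists_of_unique ?_ ?_
  · let T : EuclideanSpace ℂ ι →ₗ[ℂ] W :=
      { toFun := fun a => ∑ i, a i • u i
        map_add' := fun a b => by simp [add_smul, Finset.sum_add_distrib]
        map_smul' := fun k a => by simp [mul_smul, Finset.smul_sum] }
    have hT : Function.Surjective T := by
      intro w
      have hw : w ∈ Submodule.span ℂ (range u) := by rw [hu]; trivial
      obtain ⟨a, ha⟩ := (Submodule.mem_span_range_iff_exists_fun ℂ).1 hw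
      exact ⟨WithLp.toLp 2 a, ha⟩
    have hL : ∀ w : W, ∃ a ∈ (LinearMap.ker T)ᗮ, T a = w := by
      intro w
      obtain ⟨a, ha⟩ := hT w
      obtain ⟨y, hy, z, hz, rfl⟩ := (LinearMap.ker T).exists_add_mem_mem_orthogonal a
      refine ⟨z, hz, ?_⟩
      rw [← ha, map_add, LinearMap.mem_ker.1 hy, zero_add]
    choose L hL hTL using hL
    have huniq : ∀ a b : EuclideanSpace ℂ ι, a ∈ (LinearMap.ker T)ᗮ → b ∈ (LinearMap.ker T)ᗮ →
        T a = T b → a = b := by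
      intro a b ha hb h
      have h1 : a - b ∈ LinearMap.ker T := by rw [LinearMap.mem_ker, map_sub, h, sub_self]
      have h2 := (LinearMap.ker T)ᗮ.sub_mem ha hb
      have h3 := (Submodule.mem_orthogonal _ _).1 h2 _ h1
      exact sub_eq_zero.1 (inner_self_eq_zero.1 h3)
    have hadd : ∀ v w, L (v + w) = L v + L w := fun v w =>
      huniq _ _ (hL _) (Submodule.add_mem _ (hL _) (hL _)) (by simp only [map_add, hTL])
    have hsmul : ∀ (k : ℂ) v, L (k • v) = k • L v := fun k v =>
      huniq _ _ (hL _) (Submodule.smul_mem _ _ (hL _)) (by simp only [map_smul, hTL])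
    refine ⟨{ inner := fun v w => inner ℂ (L v) (L w)
              conj_inner_symm := fun v w => inner_conj_symm _ _
              re_inner_nonneg := fun v => inner_self_nonneg
              add_left := fun u v w => by simp only [hadd, inner_add_left]
              smul_left := fun v w k => by simp only [hsmul, inner_smul_left]
              definite := fun v hv => by
                have : L v = 0 := inner_self_eq_zero.1 hv
                rw [← hTL v, this, map_zero] }, fun w => ?_⟩
    have key : ∀ i, inner ℂ (L (u i)) (L w) = L w i := by
      intro i
      have h1 : EuclideanSpace.single i (1 : ℂ) - L (u i) ∈ LinearMap.ker T := by
        rw [LinearMap.mem_ker, map_sub, hTL]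
        simp [T]
      have h2 := (Submodule.mem_orthogonal _ _).1 (hL w) _ h1
      rw [inner_sub_left, sub_eq_zero] at h2
      rw [← h2]
      simp [EuclideanSpace.inner_single_left]
    change ∑ i, inner ℂ (L (u i)) (L w) • u i = w
    simp only [key]
    exact hTL w
  · intro c c' h h'
    refine core_ext fun v w => ?_
    calc c.inner v w = c.inner v (∑ i, c'.inner (u i) w • u i) := by rw [h']
      _ = ∑ i, c'.inner (u i) w * c.inner v (u i) := by
        simp only [core_sum_right, core_smul_right]
      _ = c'.inner (∑ i, c.inner (u i) v • u i) w := by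
        simp only [core_sum_left, c'.smul_left, c.conj_inner_symm, mul_comm]
      _ = c'.inner v w := by rw [h]

/-- Matrix `∑ᵢ Sᵢ Sᵢ*` of a family of coordinate vectors. -/
def frameMatrix {ι : Type*} [Fintype ι] {r : ℕ} (S : ι → Fin r → ℂ) : Matrix (Fin r) (Fin r) ℂ :=
  Matrix.of fun a b => ∑ i, S i a * conj (S i b)

theorem core_coord {W : Type*} [AddCommGroup W] [Module ℂ W] {r : ℕ} (c : InnerProductSpace.Core ℂ W)
    (L : (Fin r → ℂ) →ₗ[ℂ] W) (v w : Fin r → ℂ) :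
    c.inner (L v) (L w) = ∑ a, ∑ b, conj (v a) *
      (c.inner (L (Pi.single a 1)) (L (Pi.single b 1)) * w b) := by
  have hv : ∀ v : Fin r → ℂ, L v = ∑ a, v a • L (Pi.single a 1) := by
    intro v
    conv_lhs => rw [pi_eq_sum_univ' v]
    simp only [map_sum, map_smul]
  rw [hv v, hv w]
  simp only [core_sum_left, core_sum_right, core_smul_right, c.smul_left, Finset.mul_sum]
  rw [Finset.sum_comm]
  refine Finset.sum_congr rfl fun a _ => Finset.sum_congr rfl fun b _ => ?_
  ring

theorem parseval_coord {W ι : Type*} [AddCommGroup W] [Module ℂ W] [Fintype ι] {r : ℕ}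
    (c : InnerProductSpace.Core ℂ W) (L : (Fin r → ℂ) ≃ₗ[ℂ] W) (S : ι → Fin r → ℂ)
    (hc : ∀ w, ∑ i, c.inner (L (S i)) w • L (S i) = w) :
    frameMatrix S * (Matrix.of fun a b => c.inner (L (Pi.single a 1)) (L (Pi.single b 1))) = 1 := by
  ext a b
  have h := congrFun (L.injective (a₁ := ∑ i, c.inner (L (S i)) (L (Pi.single b 1)) • S i)
    (a₂ := Pi.single b 1) (by simpa only [map_sum, map_smul] using hc (L (Pi.single b 1)))) a
  rw [Matrix.one_apply, Matrix.mul_apply]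
  simp only [Finset.sum_apply, Pi.smul_apply, smul_eq_mul, Pi.single_apply] at h
  rw [← h]
  simp only [frameMatrix, Matrix.of_apply, Finset.sum_mul]
  rw [Finset.sum_comm]
  refine Finset.sum_congr rfl fun i _ => ?_
  have := core_coord c L.toLinearMap (S i) (Pi.single b 1)
  simp only [LinearEquiv.coe_coe] at this
  rw [this, Finset.sum_mul]
  refine Finset.sum_congr rfl fun d _ => ?_
  simp [Pi.single_apply]
  ring

theorem contDiff_det {V : Type*} [NormedAddCommGroup V] [NormedSpace ℝ V] {r : ℕ}
    {M : V → Matrix (Fin r) (Fin r) ℂ} (hM : ∀ a b, ContDiff ℝ ∞ fun v => M v a b) :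
    ContDiff ℝ ∞ fun v => (M v).det := by
  simp only [Matrix.det_apply']
  exact ContDiff.sum fun σ _ => contDiff_const.mul (contDiff_prod fun i _ => hM _ _)

theorem contDiffAt_inv_entry {V : Type*} [NormedAddCommGroup V] [NormedSpace ℝ V] {r : ℕ}
    {M : V → Matrix (Fin r) (Fin r) ℂ} (hM : ∀ a b, ContDiff ℝ ∞ fun v => M v a b) {v₀ : V}
    (h0 : (M v₀).det ≠ 0) (a b : Fin r) : ContDiffAt ℝ ∞ (fun v => (M v)⁻¹ a b) v₀ := by
  simp only [Matrix.inv_def, Matrix.smul_apply, Ring.inverse_eq_inv', smul_eq_mul,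
    Matrix.adjugate_apply]
  refine ((contDiff_det hM).contDiffAt.inv h0).mul (contDiff_det fun i j => ?_).contDiffAt
  by_cases hi : i = b
  · subst hi; simpa using contDiff_const
  · simpa [Matrix.updateRow_ne hi] using hM i j

end Parseval

section FubiniStudy
variable {E : X → Type*}
  [TopologicalSpace (TotalSpace (Fin r → ℂ) E)] [∀ x, TopologicalSpace (E x)]
  [∀ x, AddCommGroup (E x)] [∀ x, Module ℂ (E x)]
  [FiberBundle (Fin r → ℂ) E] [VectorBundle ℂ (Fin r → ℂ) E]

theorem contMDiffOn_real {m : ℕ} {f : X → (Fin m → ℂ)} {U : Set X}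
    (h : ContMDiffOn 𝓘(ℂ, Fin n → ℂ) 𝓘(ℂ, Fin m → ℂ) ω f U) :
    ContMDiffOn 𝓘(ℝ, Fin n → ℂ) 𝓘(ℝ, Fin m → ℂ) ∞ f U := by
  intro x hx
  obtain ⟨h1, h2⟩ := h x hx
  exact ⟨h1, (ContDiffWithinAt.restrict_scalars ℝ h2).of_le le_top⟩

theorem HermitianMetric.ext' {h h' : HermitianMetric n r E} (H : ∀ x, h.form x = h'.form x) :
    h = h' := by
  obtain ⟨f, _⟩ := h
  obtain ⟨f', _⟩ := h'
  have : f = f' := funext H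
  subst this
  rfl

/-- A family of sections is orthonormal with respect to the inner product `H`. -/
def IsOrthonormalFor {V ι : Type*} [AddCommGroup V] [Module ℂ V] [DecidableEq ι]
    (H : InnerProductSpace.Core ℂ V) (s : ι → V) : Prop :=
  ∀ i j, H.inner (s i) (s j) = if i = j then 1 else 0

theorem exists_orthonormal_basis {V : Type*} [AddCommGroup V] [Module ℂ V] [FiniteDimensional ℂ V]
    (H : InnerProductSpace.Core ℂ V) :
    ∃ s : Module.Basis (Fin (Module.finrank ℂ V)) ℂ V, IsOrthonormalFor H s := by
  let := H.toNormedAddCommGroup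
  let := InnerProductSpace.ofCore H.toCore
  refine ⟨(stdOrthonormalBasis ℂ V).toBasis, fun i j => ?_⟩
  have := orthonormal_iff_ite.1 (stdOrthonormalBasis ℂ V).orthonormal i j
  rw [OrthonormalBasis.coe_toBasis]
  exact this

theorem IsOrthonormalFor.expand {V ι : Type*} [AddCommGroup V] [Module ℂ V] [DecidableEq ι]
    [Fintype ι] {H : InnerProductSpace.Core ℂ V} {s : Module.Basis ι ℂ V}
    (hs : IsOrthonormalFor H s) (v : V) : v = ∑ i, H.inner (s i) v • s i := by
  conv_lhs => rw [← s.sum_repr v]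
  refine Finset.sum_congr rfl fun i _ => ?_
  congr 1
  have h : H.inner (s i) (∑ j, s.repr v j • s j) = s.repr v i := by
    simp only [core_sum_right, core_smul_right, hs i, mul_ite, mul_one, mul_zero,
      Finset.sum_ite_eq, Finset.mem_univ, if_true]
  rw [s.sum_repr] at h
  exact h.symm

/-- `∑ᵢ sᵢ ⊗ sᵢ*` does not depend on the orthonormal basis. -/
theorem sum_orthonormal_eq {V W ι : Type*} [AddCommGroup V] [Module ℂ V] [AddCommGroup W]
    [Module ℂ W] [DecidableEq ι] [Fintype ι] {H : InnerProductSpace.Core ℂ V}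
    {s t : Module.Basis ι ℂ V} (hs : IsOrthonormalFor H s) (ht : IsOrthonormalFor H t)
    (ev : V →ₗ[ℂ] W) (c : InnerProductSpace.Core ℂ W) (w : W) :
    ∑ i, c.inner (ev (s i)) w • ev (s i) = ∑ i, c.inner (ev (t i)) w • ev (t i) := by
  have h1 : ∀ i, ev (s i) = ∑ k, H.inner (t k) (s i) • ev (t k) := by
    intro i
    conv_lhs => rw [ht.expand (s i)]
    simp only [map_sum, map_smul]
  have h2 : ∀ k, ∑ i, H.inner (t k) (s i) * c.inner (ev (s i)) w = c.inner (ev (t k)) w := by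
    intro k
    conv_rhs => rw [hs.expand (t k)]
    simp only [map_sum, map_smul, core_sum_left, c.smul_left, H.conj_inner_symm]
  calc _ = ∑ i, ∑ k, (H.inner (t k) (s i) * c.inner (ev (s i)) w) • ev (t k) := by
        refine Finset.sum_congr rfl fun i _ => ?_
        conv_lhs => rhs; rw [h1 i]
        rw [Finset.smul_sum]
        refine Finset.sum_congr rfl fun k _ => ?_
        rw [smul_smul, mul_comm]
    _ = _ := by
        rw [Finset.sum_comm]
        refine Finset.sum_congr rfl fun k _ => ?_
        rw [← Finset.sum_smul, h2]

/-- Evaluation of holomorphic sections at a point. -/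
def evalAt (x : X) : HolSection n r E →ₗ[ℂ] E x where
  toFun s := s x
  map_add' _ _ := rfl
  map_smul' _ _ := rfl

variable [CompactSpace X] [T2Space X] [IsManifold 𝓘(ℂ, Fin n → ℂ) ω X]
  [ContMDiffVectorBundle ω (Fin r → ℂ) E 𝓘(ℂ, Fin n → ℂ)]

theorem exists_unique_FS (hE : IsGloballyGenerated n r E)
    (H : InnerProductSpace.Core ℂ (HolSection n r E)) :
    ∃! h : HermitianMetric n r E,
      ∀ s : Module.Basis (Fin (Module.finrank ℂ (HolSection n r E))) ℂ (HolSection n r E),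
        IsOrthonormalFor H s →
          ∀ (x : X) (w : E x), ∑ i, (h.form x).inner (s i x) w • s i x = w := by
  obtain ⟨s, hs⟩ := exists_orthonormal_basis H
  have hspan : ∀ x, Submodule.span ℂ (range fun i => s i x) = ⊤ := by
    intro x
    have h1 : (range fun i => s i x) = evalAt x '' range s := by
      rw [← range_comp]; rfl
    rw [h1, Submodule.span_image, s.span_eq, Submodule.map_top, LinearMap.range_eq_top]
    exact hE x
  refine existsUnique_of_exists_of_unique ?_ ?_
  · choose c hc _ using fun x => exists_unique_parseval (fun i => s i x) (hspan x)
    refine ⟨⟨c, fun x₀ v w => ?_⟩, fun t ht x w => ?_⟩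
    · -- smoothness in a local frame
      set e := trivializationAt (Fin r → ℂ) E x₀
      let S : X → Fin (Module.finrank ℂ (HolSection n r E)) → Fin r → ℂ :=
        fun x i => (e ⟨x, s i x⟩).2
      have hS : ContMDiffOn 𝓘(ℝ, Fin n → ℂ)
          𝓘(ℝ, Fin (Module.finrank ℂ (HolSection n r E)) → Fin r → ℂ) ∞ S e.baseSet := by
        rw [contMDiffOn_pi_space]
        exact fun i => contMDiffOn_real ((s i).contMDiffOn_coord x₀)
      have hpar : ∀ x ∈ e.baseSet, frameMatrix (S x) * (Matrix.of fun a b =>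
          (c x).inner (e.symmL ℂ x (Pi.single a 1)) (e.symmL ℂ x (Pi.single b 1))) = 1 := by
        intro x hx
        have hL : ∀ v, (e.linearEquivAt ℂ x hx).symm v = e.symmL ℂ x v := fun v =>
          (e.symmL_apply (R := ℂ) hx v).symm
        have hSx : ∀ i, (e.linearEquivAt ℂ x hx).symm (S x i) = s i x := fun i =>
          (e.linearEquivAt ℂ x hx).symm_apply_apply (s i x)
        have := parseval_coord (c x) (e.linearEquivAt ℂ x hx).symm (S x)
          (fun w => by simpa only [hSx] using hc x w)
        simpa only [hL] using this
      have hgram : ∀ x ∈ e.baseSet, (c x).inner (e.symmL ℂ x v) (e.symmL ℂ x w) =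
          ∑ a, ∑ b, conj (v a) * ((frameMatrix (S x))⁻¹ a b * w b) := by
        intro x hx
        have h1 := core_coord (c x) (e.symmL ℂ x).toLinearMap v w
        simp only [ContinuousLinearMap.coe_coe] at h1
        rw [h1, Matrix.inv_eq_right_inv (hpar x hx)]
        rfl
      have hΦ : ∀ x ∈ e.baseSet, ContDiffAt ℝ ∞
          (fun T : Fin (Module.finrank ℂ (HolSection n r E)) → Fin r → ℂ =>
            ∑ a, ∑ b, conj (v a) * ((frameMatrix T)⁻¹ a b * w b)) (S x) := by
        intro x hx
        refine ContDiffAt.sum fun a _ => ContDiffAt.sum fun b _ => contDiffAt_const.mul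
          ((contDiffAt_inv_entry (M := frameMatrix) (fun a b => ?_) ?_ a b).mul contDiffAt_const)
        · change ContDiff ℝ ∞
            (fun T : Fin (Module.finrank ℂ (HolSection n r E)) → Fin r → ℂ =>
              ∑ i, T i a * conj (T i b))
          refine ContDiff.sum fun i _ => ContDiff.mul ?_ ?_
          · fun_prop
          · exact (ContinuousLinearEquiv.contDiff (𝕜 := ℝ) Complex.conjCLE).comp (by fun_prop)
        · have := congrArg Matrix.det (hpar x hx)
          rw [Matrix.det_mul, Matrix.det_one] at this
          exact left_ne_zero_of_mul_eq_one this
      refine ContMDiffOn.congr (f := fun x => ∑ a, ∑ b, conj (v a) *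
        ((frameMatrix (S x))⁻¹ a b * w b)) (fun x hx => ?_) hgram
      exact (hΦ x hx).contMDiffAt.comp_contMDiffWithinAt x (hS x hx)
    · exact (sum_orthonormal_eq ht hs (evalAt x) (c x) w).trans (hc x w)
  · intro h h' hh hh'
    refine HermitianMetric.ext' fun x => ?_
    exact (exists_unique_parseval (fun i => s i x) (hspan x)).unique (hh s hs x) (hh' s hs x)

/-- The Fubini–Study map `FS : M → K`: `FS H` is the unique Hermitian metric `h` on `E` such that
`∑ᵢ sᵢ ⊗ sᵢ^{*h}` is the identity of `E`, where `s` is any `H`-orthonormal basis of `H⁰(X, E)` and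
`(s ⊗ s^{*h}) w = h(w, s) s`. -/
def FS (hE : IsGloballyGenerated n r E) (H : InnerProductSpace.Core ℂ (HolSection n r E)) :
    HermitianMetric n r E :=
  (exists_unique_FS hE H).choose

theorem FS_spec (hE : IsGloballyGenerated n r E)
    (H : InnerProductSpace.Core ℂ (HolSection n r E))
    (s : Module.Basis (Fin (Module.finrank ℂ (HolSection n r E))) ℂ (HolSection n r E))
    (hs : IsOrthonormalFor H s) (x : X) (w : E x) :
    ∑ i, ((FS hE H).form x).inner (s i x) w • s i x = w :=
  (exists_unique_FS hE H).choose_spec.1 s hs x w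

end FubiniStudy

section Gram
variable {E : X → Type*}
  [TopologicalSpace (TotalSpace (Fin r → ℂ) E)] [∀ x, TopologicalSpace (E x)]
  [∀ x, AddCommGroup (E x)] [∀ x, Module ℂ (E x)]
  [FiberBundle (Fin r → ℂ) E] [VectorBundle ℂ (Fin r → ℂ) E]

open scoped ComplexOrder in
theorem HermitianMetric.gram_posDef (h : HermitianMetric n r E) {x₀ x : X}
    (hx : x ∈ (trivializationAt (Fin r → ℂ) E x₀).baseSet) : (h.gram x₀ x).PosDef := by
  refine Matrix.PosDef.of_dotProduct_mulVec_pos ?_ ?_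
  · ext a b
    simp only [HermitianMetric.gram, Matrix.conjTranspose_apply, Matrix.of_apply]
    exact (h.form x).conj_inner_symm _ _
  · intro v hv
    set e := trivializationAt (Fin r → ℂ) E x₀
    have h1 := core_coord (h.form x) (e.symmL ℂ x).toLinearMap v v
    simp only [ContinuousLinearMap.coe_coe] at h1
    have h2 : star v ⬝ᵥ (h.gram x₀ x).mulVec v =
        (h.form x).inner (e.symmL ℂ x v) (e.symmL ℂ x v) := by
      rw [h1]
      simp only [dotProduct, Matrix.mulVec, Finset.mul_sum, HermitianMetric.gram, Matrix.of_apply]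
      rfl
    have h3 : e.symmL ℂ x v ≠ 0 := by
      intro h0
      apply hv
      have := e.continuousLinearMapAt_symmL (R := ℂ) hx v
      rw [← this, h0, map_zero]
    rw [h2, Complex.lt_def]
    have him : ((h.form x).inner (e.symmL ℂ x v) (e.symmL ℂ x v)).im = 0 :=
      Complex.conj_eq_iff_im.1 ((h.form x).conj_inner_symm _ _)
    refine ⟨lt_of_le_of_ne ((h.form x).re_inner_nonneg _) fun h0 => h3 ?_, by simp [him]⟩
    exact (h.form x).definite _ (Complex.ext h0.symm him)

open scoped ComplexOrder in
theorem HermitianMetric.gram_det_pos (h : HermitianMetric n r E) {x₀ x : X}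
    (hx : x ∈ (trivializationAt (Fin r → ℂ) E x₀).baseSet) : 0 < (h.gram x₀ x).det.re :=
  (Complex.lt_def.1 (h.gram_posDef hx).det_pos).1

open scoped ComplexOrder in
theorem HermitianMetric.gram_det_im (h : HermitianMetric n r E) {x₀ x : X}
    (hx : x ∈ (trivializationAt (Fin r → ℂ) E x₀).baseSet) : (h.gram x₀ x).det.im = 0 :=
  (Complex.lt_def.1 (h.gram_posDef hx).det_pos).2.symm

theorem HermitianMetric.continuousOn_gram_det (h : HermitianMetric n r E) (x₀ : X) :
    ContinuousOn (fun x => (h.gram x₀ x).det.re)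
      (trivializationAt (Fin r → ℂ) E x₀).baseSet := by
  refine Complex.continuous_re.comp_continuousOn ?_
  simp only [Matrix.det_apply']
  refine continuousOn_finsetSum _ fun σ _ => continuousOn_const.mul
    (continuousOn_finsetProd _ fun i _ => ?_)
  exact (h.smooth x₀ (Pi.single (σ i) 1) (Pi.single i 1)).continuousOn

/-- Change of frame for the determinant of the Gram matrix. -/
theorem core_det_comp {W : Type*} [AddCommGroup W] [Module ℂ W] (c : InnerProductSpace.Core ℂ W)
    (L : (Fin r → ℂ) →ₗ[ℂ] W) (T : (Fin r → ℂ) →ₗ[ℂ] (Fin r → ℂ)) :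
    (Matrix.of fun a b : Fin r =>
        c.inner (L (T (Pi.single a 1))) (L (T (Pi.single b 1)))).det.re =
      Complex.normSq (LinearMap.det T) * (Matrix.of fun a b : Fin r =>
        c.inner (L (Pi.single a 1)) (L (Pi.single b 1))).det.re := by
  have h : (Matrix.of fun a b : Fin r =>
      c.inner (L (T (Pi.single a 1))) (L (T (Pi.single b 1)))) =
      (LinearMap.toMatrix' T).conjTranspose * (Matrix.of fun a b : Fin r =>
        c.inner (L (Pi.single a 1)) (L (Pi.single b 1))) * LinearMap.toMatrix' T := by
    ext a b
    rw [Matrix.mul_assoc, Matrix.mul_apply, Matrix.of_apply, core_coord]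
    refine Finset.sum_congr rfl fun i _ => ?_
    rw [Matrix.mul_apply, Finset.mul_sum]
    refine Finset.sum_congr rfl fun j _ => ?_
    simp only [Matrix.conjTranspose_apply, LinearMap.toMatrix'_apply, Matrix.of_apply]
    rfl
  rw [h, Matrix.det_mul, Matrix.det_mul, Matrix.det_conjTranspose, LinearMap.det_toMatrix',
    mul_right_comm]
  have : star (LinearMap.det T) * LinearMap.det T = (Complex.normSq (LinearMap.det T) : ℂ) :=
    Complex.normSq_eq_conj_mul_self.symm
  rw [this, Complex.re_ofReal_mul]
end Gram

section Kaehler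
variable [IsManifold 𝓘(ℂ, Fin n → ℂ) ω X]

/-- The fundamental `(1,1)`-form `ω(v, w) = Re h(Jv, w) = Im h(v, w)` of a Hermitian metric `h` on
the holomorphic tangent bundle, in the holomorphic coordinates `z` of the preferred chart at `x₀`
and evaluated on the coordinate (constant) vector fields `v`, `w`. The inverse trivialization of the
tangent bundle used here is the derivative of the inverse of that chart. -/
def HermitianMetric.localForm
    (h : HermitianMetric n n (TangentSpace 𝓘(ℂ, Fin n → ℂ) : X → Type _)) (x₀ : X)
    (v w : Fin n → ℂ) (z : Fin n → ℂ) : ℝ :=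
  ((h.form ((chartAt (Fin n → ℂ) x₀).symm z)).inner
    ((trivializationAt (Fin n → ℂ) (TangentSpace 𝓘(ℂ, Fin n → ℂ)) x₀).symmL ℂ
      ((chartAt (Fin n → ℂ) x₀).symm z) v)
    ((trivializationAt (Fin n → ℂ) (TangentSpace 𝓘(ℂ, Fin n → ℂ)) x₀).symmL ℂ
      ((chartAt (Fin n → ℂ) x₀).symm z) w)).im

variable (n X) in
/-- Kähler metrics on the complex manifold `X`: smooth Hermitian metrics on the holomorphic tangent
bundle whose fundamental form `ω` is closed. The three terms of `closed` are `dω(u, v, w)` for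
constant vector fields in a holomorphic chart. -/
structure KaehlerMetric extends
    HermitianMetric n n (TangentSpace 𝓘(ℂ, Fin n → ℂ) : X → Type _) where
  closed : ∀ (x₀ : X), ∀ z ∈ (chartAt (Fin n → ℂ) x₀).target, ∀ u v w : Fin n → ℂ,
    fderiv ℝ (toHermitianMetric.localForm x₀ v w) z u +
      fderiv ℝ (toHermitianMetric.localForm x₀ w u) z v +
      fderiv ℝ (toHermitianMetric.localForm x₀ u v) z w = 0

namespace KaehlerMetric
variable (g : KaehlerMetric n X)

/-- The coordinate expression `det (h(∂_j, ∂_k))` of the volume form `ωⁿ / n!` with respect to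
Lebesgue measure in the preferred chart at `x₀`, where
`ω = (i/2) ∑ h(∂_k, ∂_j) dz_j ∧ dz̄_k`. -/
def density (x₀ : X) (z : Fin n → ℂ) : ℝ :=
  (g.gram x₀ ((chartAt (Fin n → ℂ) x₀).symm z)).det.re

theorem continuousOn_density (x₀ : X) :
    ContinuousOn (g.density x₀) (chartAt (Fin n → ℂ) x₀).target := by
  refine (g.continuousOn_gram_det x₀).comp (chartAt (Fin n → ℂ) x₀).continuousOn_symm fun z hz => ?_
  rw [TangentBundle.trivializationAt_baseSet]
  exact (chartAt (Fin n → ℂ) x₀).map_target hz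

theorem density_pos (x₀ : X) {z : Fin n → ℂ} (hz : z ∈ (chartAt (Fin n → ℂ) x₀).target) :
    0 < g.density x₀ z := by
  refine g.gram_det_pos ?_
  rw [TangentBundle.trivializationAt_baseSet]
  exact (chartAt (Fin n → ℂ) x₀).map_target hz

theorem gram_det_change {x y p : X} (hx : p ∈ (chartAt (Fin n → ℂ) x).source)
    (hy : p ∈ (chartAt (Fin n → ℂ) y).source) :
    (g.gram x p).det.re =
      |((tangentCoordChange 𝓘(ℂ, Fin n → ℂ) x y p).restrictScalars ℝ).det| *
        (g.gram y p).det.re := by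
  have hsymm : ∀ v : Fin n → ℂ,
      (trivializationAt (Fin n → ℂ) (TangentSpace 𝓘(ℂ, Fin n → ℂ)) x).symmL ℂ p v =
      (trivializationAt (Fin n → ℂ) (TangentSpace 𝓘(ℂ, Fin n → ℂ)) y).symmL ℂ p
        (tangentCoordChange 𝓘(ℂ, Fin n → ℂ) x y p v) := by
    intro v
    rw [TangentBundle.symmL_trivializationAt_eq_core hx,
      TangentBundle.symmL_trivializationAt_eq_core hy]
    exact (tangentCoordChange_comp (I := 𝓘(ℂ, Fin n → ℂ)) (w := x) (x := y) (y := p) (z := p)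
      (by simpa using ⟨hx, hy⟩)).symm
  have h := core_det_comp (g.form p)
    ((trivializationAt (Fin n → ℂ) (TangentSpace 𝓘(ℂ, Fin n → ℂ)) y).symmL ℂ p).toLinearMap
    (tangentCoordChange 𝓘(ℂ, Fin n → ℂ) x y p).toLinearMap
  have hdet : ((tangentCoordChange 𝓘(ℂ, Fin n → ℂ) x y p).restrictScalars ℝ).det =
      Complex.normSq
        (LinearMap.det (tangentCoordChange 𝓘(ℂ, Fin n → ℂ) x y p).toLinearMap) := by
    rw [← Algebra.norm_complex_apply, ← LinearMap.det_restrictScalars]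
    rfl
  rw [hdet, abs_of_nonneg (Complex.normSq_nonneg _)]
  simp only [ContinuousLinearMap.coe_coe, ← hsymm] at h
  exact h

variable [MeasurableSpace X] [BorelSpace X]

/-- The measure of the volume form `ωⁿ / n!` on the domain of the preferred chart at `x₀`, extended
by zero to `X`. -/
def localVolume (x₀ : X) : Measure X :=
  ((volume.restrict (chartAt (Fin n → ℂ) x₀).target).withDensity fun z =>
    ENNReal.ofReal (g.density x₀ z)).map (chartAt (Fin n → ℂ) x₀).symm

/-- The measure `ωⁿ / n!` on `X`: the least measure that dominates its local expressions in all
preferred charts. By `volumeMeasure_restrict` below it restricts to each of them. -/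
def volumeMeasure : Measure X := ⨆ x₀ : X, g.localVolume x₀

theorem measurableSet_chart_preimage (x₀ : X) {A : Set X} (hA : MeasurableSet A) :
    MeasurableSet ((chartAt (Fin n → ℂ) x₀).target ∩ (chartAt (Fin n → ℂ) x₀).symm ⁻¹' A) := by
  have h := (continuousOn_iff_continuous_domRestrict.1
    (chartAt (Fin n → ℂ) x₀).continuousOn_symm).measurable hA
  have h2 := (MeasurableEmbedding.subtype_coe
    (chartAt (Fin n → ℂ) x₀).open_target.measurableSet).measurableSet_image.2 h
  convert h2 using 1
  ext z
  simp [and_comm]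

theorem localVolume_apply (x₀ : X) {A : Set X} (hA : MeasurableSet A) :
    g.localVolume x₀ A =
      ∫⁻ z in (chartAt (Fin n → ℂ) x₀).target ∩ (chartAt (Fin n → ℂ) x₀).symm ⁻¹' A,
        ENNReal.ofReal (g.density x₀ z) := by
  have hm : AEMeasurable (chartAt (Fin n → ℂ) x₀).symm
      (volume.restrict (chartAt (Fin n → ℂ) x₀).target) :=
    (chartAt (Fin n → ℂ) x₀).continuousOn_symm.aemeasurable
      (chartAt (Fin n → ℂ) x₀).open_target.measurableSet
  have hm' := hm.mono_ac (withDensity_absolutelyContinuous _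
    (fun z => ENNReal.ofReal (g.density x₀ z)))
  rw [localVolume, Measure.map_apply_of_aemeasurable hm' hA, withDensity_apply',
    Measure.restrict_restrict₀ (hm.nullMeasurableSet_preimage hA), inter_comm]

theorem localVolume_compat (x y : X) {A : Set X} (hA : MeasurableSet A)
    (hx : A ⊆ (chartAt (Fin n → ℂ) x).source) (hy : A ⊆ (chartAt (Fin n → ℂ) y).source) :
    g.localVolume x A = g.localVolume y A := by
  set φ := chartAt (Fin n → ℂ) x with hφ
  set ψ := chartAt (Fin n → ℂ) y with hψ
  rw [localVolume_apply g x hA, localVolume_apply g y hA, ← hφ, ← hψ]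
  set P := φ.target ∩ φ.symm ⁻¹' A with hP
  have himage : ψ.target ∩ ψ.symm ⁻¹' A = (ψ ∘ φ.symm) '' P := by
    ext w
    constructor
    · rintro ⟨hw, hwA⟩
      refine ⟨φ (ψ.symm w), ⟨φ.map_source (hx hwA), ?_⟩, ?_⟩
      · rw [mem_preimage, φ.left_inv (hx hwA)]; exact hwA
      · rw [Function.comp_apply, φ.left_inv (hx hwA), ψ.right_inv hw]
    · rintro ⟨z, ⟨hz, hzA⟩, rfl⟩
      refine ⟨ψ.map_source (hy hzA), ?_⟩
      rw [mem_preimage, Function.comp_apply, ψ.left_inv (hy hzA)]; exact hzA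
  have hinj : InjOn (ψ ∘ φ.symm) P := by
    rintro z ⟨hz, hzA⟩ z' ⟨hz', hzA'⟩ h
    exact φ.symm.injOn hz hz' (ψ.injOn (hy hzA) (hy hzA') h)
  have hder : ∀ z ∈ P, HasFDerivWithinAt (ψ ∘ φ.symm)
      ((tangentCoordChange 𝓘(ℂ, Fin n → ℂ) x y (φ.symm z)).restrictScalars ℝ) P z := by
    rintro z ⟨hz, hzA⟩
    have h1 := hasFDerivWithinAt_tangentCoordChange (I := 𝓘(ℂ, Fin n → ℂ)) (x := x) (y := y)
      (z := φ.symm z) (by simpa using ⟨φ.map_target hz, hy hzA⟩)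
    have h2 : extChartAt 𝓘(ℂ, Fin n → ℂ) x (φ.symm z) = z := by
      simp [← hφ, φ.right_inv hz]
    rw [h2] at h1
    simp only [mfld_simps] at h1
    exact (h1.restrictScalars ℝ).mono (subset_univ _)
  rw [himage, lintegral_image_eq_lintegral_abs_det_fderiv_mul volume
    (measurableSet_chart_preimage x hA) hder hinj]
  refine setLIntegral_congr_fun (measurableSet_chart_preimage x hA) ?_
  rintro z ⟨hz, hzA⟩
  have hyz : ψ.symm ((ψ ∘ φ.symm) z) = φ.symm z := ψ.left_inv (hy hzA)
  simp only [density]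
  rw [← ENNReal.ofReal_mul (abs_nonneg _), ← hψ, hyz, ← gram_det_change g (hx hzA) (hy hzA)]

theorem localVolume_compl (x₀ : X) :
    g.localVolume x₀ (chartAt (Fin n → ℂ) x₀).sourceᶜ = 0 := by
  rw [localVolume_apply g x₀ (chartAt (Fin n → ℂ) x₀).open_source.measurableSet.compl]
  have : (chartAt (Fin n → ℂ) x₀).target ∩
      (chartAt (Fin n → ℂ) x₀).symm ⁻¹' (chartAt (Fin n → ℂ) x₀).sourceᶜ = ∅ := by
    ext z
    simp only [mem_inter_iff, mem_preimage, mem_compl_iff, mem_empty_iff_false, iff_false, not_and,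
      not_not]
    exact fun hz => (chartAt (Fin n → ℂ) x₀).map_target hz
  rw [this]
  simp

theorem localVolume_inter_source (x₀ : X) (A : Set X) :
    g.localVolume x₀ (A ∩ (chartAt (Fin n → ℂ) x₀).source) = g.localVolume x₀ A :=
  measure_inter_conull (g.localVolume_compl x₀)

/-- The volume measure restricts, on the domain of each preferred chart, to the measure given by
the coordinate expression of the volume form. -/
theorem volumeMeasure_restrict (x₀ : X) :
    g.volumeMeasure.restrict (chartAt (Fin n → ℂ) x₀).source = g.localVolume x₀ := by
  set S := (chartAt (Fin n → ℂ) x₀).source with hS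
  have hSm : MeasurableSet S := (chartAt (Fin n → ℂ) x₀).open_source.measurableSet
  have hle : ∀ y, g.localVolume y ≤ g.volumeMeasure := fun y => le_iSup g.localVolume y
  have hup : g.volumeMeasure ≤ g.localVolume x₀ + g.volumeMeasure.restrict Sᶜ := by
    refine iSup_le fun y => Measure.le_iff.2 fun A hA => ?_
    rw [Measure.add_apply, Measure.restrict_apply hA, ← measure_inter_add_sdiff A hSm]
    refine add_le_add ?_ ((hle y) _)
    have hSy : MeasurableSet (chartAt (Fin n → ℂ) y).source :=
      (chartAt (Fin n → ℂ) y).open_source.measurableSet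
    rw [← localVolume_inter_source g y,
      g.localVolume_compat y x₀ ((hA.inter hSm).inter hSy) inter_subset_right
        (inter_subset_left.trans inter_subset_right)]
    exact measure_mono (inter_subset_left.trans inter_subset_left)
  ext A hA
  rw [Measure.restrict_apply hA, ← localVolume_inter_source g x₀ A, ← hS]
  refine le_antisymm ?_ (hle x₀ _)
  refine (hup _).trans ?_
  rw [Measure.add_apply, Measure.restrict_apply (hA.inter hSm)]
  have : A ∩ S ∩ Sᶜ = ∅ := by rw [inter_assoc, inter_compl_self, inter_empty]
  simp [this]

theorem localVolume_lt_top (x₀ : X) [T2Space X] {K : Set X} (hK : IsCompact K)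
    (hKs : K ⊆ (chartAt (Fin n → ℂ) x₀).source) : g.localVolume x₀ K < ⊤ := by
  set φ := chartAt (Fin n → ℂ) x₀ with hφ
  rw [localVolume_apply g x₀ hK.isClosed.measurableSet, ← hφ]
  have himg : φ.target ∩ φ.symm ⁻¹' K = φ '' K := by
    rw [φ.image_eq_target_inter_inv_preimage hKs]
  have hc : IsCompact (φ '' K) := hK.image_of_continuousOn (φ.continuousOn.mono hKs)
  rw [himg]
  have hint : IntegrableOn (g.density x₀) (φ '' K) :=
    ((g.continuousOn_density x₀).mono (by rw [← himg]; exact inter_subset_left)).integrableOn_compact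
      hc
  exact hint.lintegral_lt_top

instance [T2Space X] [CompactSpace X] : IsFiniteMeasure g.volumeMeasure := by
  have h : ∀ x : X, ∃ K : Set X, IsCompact K ∧ x ∈ interior K ∧
      K ⊆ (chartAt (Fin n → ℂ) x).source := fun x =>
    exists_compact_subset (chartAt (Fin n → ℂ) x).open_source (mem_chart_source _ x)
  choose K hK hxK hKs using h
  obtain ⟨t, ht⟩ := CompactSpace.elim_nhds_subcover K fun x => mem_interior_iff_mem_nhds.1 (hxK x)
  refine ⟨?_⟩
  have htop : (univ : Set X) = ⋃ x ∈ t, K x := ht.symm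
  rw [htop]
  refine (measure_biUnion_finset_le t K).trans_lt (ENNReal.sum_lt_top.2 fun x _ => ?_)
  have := g.localVolume_lt_top x (hK x) (hKs x)
  rwa [← volumeMeasure_restrict, Measure.restrict_eq_self _ (hKs x)] at this

instance : g.volumeMeasure.IsOpenPosMeasure := by
  refine ⟨fun U hU ⟨p, hp⟩ h0 => ?_⟩
  have h1 : g.localVolume p U = 0 := le_antisymm ((le_iSup g.localVolume p U).trans h0.le) bot_le
  set φ := chartAt (Fin n → ℂ) p with hφ
  rw [localVolume_apply g p hU.measurableSet, ← hφ] at h1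
  have hV : IsOpen (φ.target ∩ φ.symm ⁻¹' U) := φ.isOpen_inter_preimage_symm hU
  have hne : (φ.target ∩ φ.symm ⁻¹' U).Nonempty := by
    refine ⟨φ p, mem_chart_target _ p, ?_⟩
    rw [mem_preimage, φ.left_inv (mem_chart_source _ p)]
    exact hp
  have hpos : ∀ z ∈ φ.target ∩ φ.symm ⁻¹' U, ENNReal.ofReal (g.density p z) ≠ 0 := fun z hz =>
    (ENNReal.ofReal_pos.2 (g.density_pos p hz.1)).ne'
  have hmeas : AEMeasurable (fun z => ENNReal.ofReal (g.density p z))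
      (volume.restrict (φ.target ∩ φ.symm ⁻¹' U)) :=
    (((g.continuousOn_density p).mono inter_subset_left).aemeasurable hV.measurableSet).ennreal_ofReal
  rw [lintegral_eq_zero_iff' hmeas, Filter.EventuallyEq, ae_restrict_iff' hV.measurableSet] at h1
  have h2 : volume (φ.target ∩ φ.symm ⁻¹' U) = 0 := by
    refine measure_mono_null (fun z hz => ?_) h1
    simp only [mem_compl_iff, mem_ofPred_eq, Classical.not_imp]
    exact ⟨hz, hpos z hz⟩
  exact (hV.measure_pos volume hne).ne' h2

end KaehlerMetric
end Kaehler

section Functionals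
variable {E : X → Type*}
  [TopologicalSpace (TotalSpace (Fin r → ℂ) E)] [∀ x, TopologicalSpace (E x)]
  [∀ x, AddCommGroup (E x)] [∀ x, Module ℂ (E x)]
  [FiberBundle (Fin r → ℂ) E] [VectorBundle ℂ (Fin r → ℂ) E]

theorem HermitianMetric.continuous_inner [IsManifold 𝓘(ℂ, Fin n → ℂ) ω X]
    [ContMDiffVectorBundle ω (Fin r → ℂ) E 𝓘(ℂ, Fin n → ℂ)] (h : HermitianMetric n r E) (s t : HolSection n r E) :
    Continuous fun x => (h.form x).inner (s x) (t x) := by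
  refine continuous_iff_continuousAt.2 fun x₀ => ?_
  set e := trivializationAt (Fin r → ℂ) E x₀
  have hx₀ : x₀ ∈ e.baseSet := mem_baseSet_trivializationAt _ _ x₀
  have hcoord : ∀ s : HolSection n r E, ContinuousOn (fun x => (e ⟨x, s x⟩).2) e.baseSet := fun s =>
    (s.contMDiffOn_coord x₀).continuousOn
  have hloc : ∀ x ∈ e.baseSet, (h.form x).inner (s x) (t x) =
      ∑ a, ∑ b, conj ((e ⟨x, s x⟩).2 a) * ((h.form x).inner (e.symmL ℂ x (Pi.single a 1))
        (e.symmL ℂ x (Pi.single b 1)) * (e ⟨x, t x⟩).2 b) := by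
    intro x hx
    have h1 := core_coord (h.form x) (e.symmL ℂ x).toLinearMap (e ⟨x, s x⟩).2 (e ⟨x, t x⟩).2
    simp only [ContinuousLinearMap.coe_coe] at h1
    rw [← h1, e.symmL_apply (R := ℂ) hx, e.symmL_apply (R := ℂ) hx, e.symm_apply_apply_mk hx,
      e.symm_apply_apply_mk hx]
  refine ContinuousOn.continuousAt ?_ (e.open_baseSet.mem_nhds hx₀)
  refine ContinuousOn.congr ?_ hloc
  refine continuousOn_finsetSum _ fun a _ => continuousOn_finsetSum _ fun b _ => ?_
  refine ContinuousOn.mul ?_ (ContinuousOn.mul (h.smooth x₀ _ _).continuousOn ?_)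
  · exact Complex.continuous_conj.comp_continuousOn
      ((continuous_apply a).comp_continuousOn (hcoord s))
  · exact (continuous_apply b).comp_continuousOn (hcoord t)

variable [CompactSpace X] [T2Space X] [MeasurableSpace X] [BorelSpace X]
  [IsManifold 𝓘(ℂ, Fin n → ℂ) ω X] [ContMDiffVectorBundle ω (Fin r → ℂ) E 𝓘(ℂ, Fin n → ℂ)]

theorem integrable_inner (g : KaehlerMetric n X) (h : HermitianMetric n r E)
    (s t : HolSection n r E) :
    Integrable (fun x => (h.form x).inner (s x) (t x)) g.volumeMeasure :=
  (h.continuous_inner s t).integrable_of_hasCompactSupport (HasCompactSupport.of_compactSpace _)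

theorem re_integral_inner (g : KaehlerMetric n X) (h : HermitianMetric n r E)
    (s t : HolSection n r E) :
    (∫ x, (h.form x).inner (s x) (t x) ∂g.volumeMeasure).re =
      ∫ x, ((h.form x).inner (s x) (t x)).re ∂g.volumeMeasure :=
  (Complex.reCLM.integral_comp_comm (integrable_inner g h s t)).symm

/-- The map `Hilb : K → M`, `⟨s, t⟩_{Hilb h} = N / (V r) ∫_X h(s, t) ωⁿ / n!`, where
`N = dim H⁰(X, E)` and `V` is the volume of `X`. -/
@[reducible] def Hilb (g : KaehlerMetric n X) (h : HermitianMetric n r E) :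
    InnerProductSpace.Core ℂ (HolSection n r E) where
  inner s t := ((Module.finrank ℂ (HolSection n r E) / (g.volumeMeasure.real univ * r) : ℝ) : ℂ) *
    ∫ x, (h.form x).inner (s x) (t x) ∂g.volumeMeasure
  conj_inner_symm s t := by
    simp only [map_mul, Complex.conj_ofReal, ← integral_conj]
    simp only [(h.form _).conj_inner_symm]
  re_inner_nonneg s := by
    change 0 ≤ (_ : ℂ).re
    rw [Complex.re_ofReal_mul, re_integral_inner]
    exact mul_nonneg (by positivity) (integral_nonneg fun x => (h.form x).re_inner_nonneg _)
  add_left s t u := by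
    rw [← mul_add, ← integral_add (integrable_inner g h s u) (integrable_inner g h t u)]
    simp only [← (h.form _).add_left]
    rfl
  smul_left s t a := by
    have : ∀ x, (h.form x).inner ((a • s) x) (t x) = conj a * (h.form x).inner (s x) (t x) :=
      fun x => (h.form x).smul_left _ _ _
    simp only [this, integral_const_mul]
    ring
  definite s hs := by
    by_contra hne
    have hx : ∃ x, s x ≠ 0 := by
      by_contra hx
      push Not at hx
      exact hne (ContMDiffSection.ext hx)
    obtain ⟨x, hx⟩ := hx
    have hr : 0 < r := by
      rcases Nat.eq_zero_or_pos r with rfl | hr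
      · exfalso
        have e := (trivializationAt (Fin 0 → ℂ) E x).linearEquivAt ℂ x
          (mem_baseSet_trivializationAt _ _ x)
        exact hx (e.injective (Subsingleton.elim _ _))
      · exact hr
    have hN : 0 < Module.finrank ℂ (HolSection n r E) :=
      Module.finrank_pos_iff_exists_ne_zero.2 ⟨s, hne⟩
    have hV : 0 < g.volumeMeasure.real univ := by
      have : Nonempty X := ⟨x⟩
      rw [measureReal_def]
      exact ENNReal.toReal_pos (isOpen_univ.measure_pos _ univ_nonempty).ne' (measure_ne_top _ _)
    have hint : 0 < ∫ x, ((h.form x).inner (s x) (s x)).re ∂g.volumeMeasure := by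
      refine (Complex.continuous_re.comp
        (h.continuous_inner s s)).integral_pos_of_hasCompactSupport_nonneg_nonzero
          (HasCompactSupport.of_compactSpace _) (fun x => (h.form x).re_inner_nonneg _) (x := x) ?_
      intro h0
      refine hx ((h.form x).definite _ (Complex.ext h0 ?_))
      exact Complex.conj_eq_iff_im.1 ((h.form x).conj_inner_symm _ _)
    have h1 : (0 : ℝ) < Module.finrank ℂ (HolSection n r E) / (g.volumeMeasure.real univ * r) := by
      have : (0 : ℝ) < r := by exact_mod_cast hr
      positivity
    have h2 := congrArg Complex.re hs
    rw [Complex.re_ofReal_mul, re_integral_inner] at h2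
    exact (mul_pos h1 hint).ne' h2

/-- The generalized `T`-operator `T = Hilb ∘ FS : M → M`. -/
@[reducible] def T (g : KaehlerMetric n X) (hE : IsGloballyGenerated n r E)
    (H : InnerProductSpace.Core ℂ (HolSection n r E)) :
    InnerProductSpace.Core ℂ (HolSection n r E) :=
  Hilb g (FS hE H)

/-- The functional `I : K → ℝ`, normalized by `I(h₀) = 0`: `I(h) = ∫_X log det (h₀⁻¹ h) ωⁿ / n!`,
so `I(e^φ h₀) = ∫_X tr φ ωⁿ / n!`. The quotient of Gram determinants does not depend on the frame.
The variation formula that determines `I` up to a constant is `hasDerivAt_energy` below. -/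
def energy (g : KaehlerMetric n X) (h₀ h : HermitianMetric n r E) : ℝ :=
  ∫ x, Real.log ((h.gram x x).det.re / (h₀.gram x x).det.re) ∂g.volumeMeasure

/-- `log det` of a Hermitian inner product, where `det` is taken with respect to the element
`Θ = θ₁ ∧ … ∧ θ_N` of the top exterior power. -/
def logDet {V : Type*} [AddCommGroup V] [Module ℂ V] {N : ℕ} (θ : Module.Basis (Fin N) ℂ V)
    (H : InnerProductSpace.Core ℂ V) : ℝ :=
  Real.log (Matrix.of fun i j => H.inner (θ i) (θ j)).det.re

/-- `Z = - I ∘ FS`. -/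
def Z (g : KaehlerMetric n X) (hE : IsGloballyGenerated n r E) (h₀ : HermitianMetric n r E)
    (H : InnerProductSpace.Core ℂ (HolSection n r E)) : ℝ :=
  -energy g h₀ (FS hE H)

/-- `Z̃ = Z + (r V / N) log det`. -/
def Ztilde (g : KaehlerMetric n X) (hE : IsGloballyGenerated n r E) (h₀ : HermitianMetric n r E)
    (θ : Module.Basis (Fin (Module.finrank ℂ (HolSection n r E))) ℂ (HolSection n r E))
    (H : InnerProductSpace.Core ℂ (HolSection n r E)) : ℝ :=
  Z g hE h₀ H +
    r * g.volumeMeasure.real univ / Module.finrank ℂ (HolSection n r E) * logDet θ H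

/-- Boundedness in the sense of Sano: there is `R > 1` such that each `H ∈ U` has a `γ > 0` with
`γ / R ≤ |H(ξ)| / |ξ| ≤ γ R` for all `ξ ≠ 0` in `ℂ^N`, where `H` is viewed as the `N × N` matrix
`H(bᵢ, bⱼ)` in the basis `b`. -/
def IsBoundedFamily {V : Type*} [AddCommGroup V] [Module ℂ V] {N : ℕ}
    (b : Module.Basis (Fin N) ℂ V) (U : Set (InnerProductSpace.Core ℂ V)) : Prop :=
  ∃ R : ℝ, 1 < R ∧ ∀ H ∈ U, ∃ γ : ℝ, 0 < γ ∧ ∀ ξ : EuclideanSpace ℂ (Fin N),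
    γ / R * ‖ξ‖ ≤ ‖Matrix.toEuclideanCLM (𝕜 := ℂ) (Matrix.of fun i j => H.inner (b i) (b j)) ξ‖ ∧
    ‖Matrix.toEuclideanCLM (𝕜 := ℂ) (Matrix.of fun i j => H.inner (b i) (b j)) ξ‖ ≤ γ * R * ‖ξ‖

end Functionals

section Variation
variable {E : X → Type*}
  [TopologicalSpace (TotalSpace (Fin r → ℂ) E)] [∀ x, TopologicalSpace (E x)]
  [∀ x, AddCommGroup (E x)] [∀ x, Module ℂ (E x)]
  [FiberBundle (Fin r → ℂ) E] [VectorBundle ℂ (Fin r → ℂ) E]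

theorem gram_ratio_eq (h h₀ : HermitianMetric n r E) {x₀ x : X}
    (hx : x ∈ (trivializationAt (Fin r → ℂ) E x₀).baseSet) :
    (h.gram x x).det.re / (h₀.gram x x).det.re = (h.gram x₀ x).det.re / (h₀.gram x₀ x).det.re := by
  set e := trivializationAt (Fin r → ℂ) E x
  set e₀ := trivializationAt (Fin r → ℂ) E x₀
  have hxe : x ∈ e.baseSet := mem_baseSet_trivializationAt _ _ x
  let A : (Fin r → ℂ) →ₗ[ℂ] (Fin r → ℂ) :=
    (e.continuousLinearMapAt ℂ x).toLinearMap ∘ₗ (e₀.symmL ℂ x).toLinearMap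
  have hA : ∀ v, (e.symmL ℂ x).toLinearMap (A v) = e₀.symmL ℂ x v := fun v =>
    e.symmL_continuousLinearMapAt (R := ℂ) hxe _
  have key : ∀ k : HermitianMetric n r E, (k.gram x₀ x).det.re =
      Complex.normSq (LinearMap.det A) * (k.gram x x).det.re := by
    intro k
    have := core_det_comp (k.form x) (e.symmL ℂ x).toLinearMap A
    simp only [hA] at this
    exact this
  have h0 : Complex.normSq (LinearMap.det A) ≠ 0 := by
    intro h0
    have := h.gram_det_pos hx
    rw [key h, h0, zero_mul] at this
    exact lt_irrefl _ this
  rw [key h, key h₀, mul_div_mul_left _ _ h0]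

theorem continuous_log_gram_ratio (h h₀ : HermitianMetric n r E) :
    Continuous fun x => Real.log ((h.gram x x).det.re / (h₀.gram x x).det.re) := by
  refine continuous_iff_continuousAt.2 fun x₀ => ?_
  set e := trivializationAt (Fin r → ℂ) E x₀
  have hx₀ : x₀ ∈ e.baseSet := mem_baseSet_trivializationAt _ _ x₀
  refine ContinuousOn.continuousAt (s := e.baseSet) ?_ (e.open_baseSet.mem_nhds hx₀)
  refine ContinuousOn.congr (f := fun x => Real.log ((h.gram x₀ x).det.re / (h₀.gram x₀ x).det.re))
    ?_ fun x hx => by rw [gram_ratio_eq h h₀ hx]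
  exact ((h.continuousOn_gram_det x₀).div (h₀.continuousOn_gram_det x₀)
    fun x hx => (h₀.gram_det_pos hx).ne').log
      fun x hx => (div_pos (h.gram_det_pos hx) (h₀.gram_det_pos hx)).ne'

/-- Jacobi's formula. -/
theorem hasDerivAt_det {M : ℝ → Matrix (Fin r) (Fin r) ℂ} {A : Matrix (Fin r) (Fin r) ℂ} {t : ℝ}
    (hM : ∀ a b, HasDerivAt (fun s => M s a b) ((M t * A) a b) t) :
    HasDerivAt (fun s => (M s).det) ((M t).det * A.trace) t := by
  have h1 : HasDerivAt (fun s => (M s).det) (∑ σ : Equiv.Perm (Fin r),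
      ((Equiv.Perm.sign σ : ℤ) : ℂ) * ∑ i, (∏ j ∈ Finset.univ.erase i, M t (σ j) j) •
        (M t * A) (σ i) i) t := by
    simp only [Matrix.det_apply']
    exact HasDerivAt.fun_sum fun σ _ => (HasDerivAt.fun_finsetProd fun i _ => hM _ _).const_mul _
  convert h1 using 1
  have h2 : (M t).det * A.trace = ((M t).adjugate * (M t * A)).trace := by
    rw [← Matrix.mul_assoc, Matrix.adjugate_mul, Matrix.smul_mul, Matrix.one_mul,
      Matrix.trace_smul, smul_eq_mul]
  rw [h2]
  simp only [Finset.mul_sum]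
  rw [Finset.sum_comm]
  refine Finset.sum_congr rfl fun i _ => ?_
  have h3 : ((M t).adjugate * (M t * A)) i i =
      ((M t).updateCol i fun a => (M t * A) a i).det := by
    rw [← Matrix.cramer_apply, Matrix.cramer_eq_adjugate_mulVec]
    rfl
  rw [Matrix.diag_apply, h3, Matrix.det_apply']
  refine Finset.sum_congr rfl fun σ _ => ?_
  congr 1
  rw [← Finset.mul_prod_erase _ _ (Finset.mem_univ i), smul_eq_mul, mul_comm]
  congr 1
  · refine Finset.prod_congr rfl fun j hj => ?_
    rw [Matrix.updateCol_ne (Finset.ne_of_mem_erase hj)]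
  · simp

variable [CompactSpace X] [T2Space X] [MeasurableSpace X] [BorelSpace X]
  [IsManifold 𝓘(ℂ, Fin n → ℂ) ω X]

/-- First variation of the functional `I`: along a path of Hermitian metrics with logarithmic
derivative `A t = (h t)⁻¹ ∂ₜ (h t)`, the derivative of `I` is `∫ tr (A t)`. For `h t = e^{φ t} h₀`
one has `tr (A t) = tr (∂ₜ φ t)`. -/
theorem hasDerivAt_energy (g : KaehlerMetric n X) (h₀ : HermitianMetric n r E)
    (h : ℝ → HermitianMetric n r E) (A : ℝ → ∀ x, E x →ₗ[ℂ] E x)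
    (hA : ∀ t x v w, HasDerivAt (fun s => ((h s).form x).inner v w)
      (((h t).form x).inner v (A t x w)) t)
    (hc : Continuous fun p : ℝ × X => LinearMap.trace ℂ (E p.2) (A p.1 p.2)) (t : ℝ) :
    HasDerivAt (fun s => energy g h₀ (h s))
      (∫ x, (LinearMap.trace ℂ (E x) (A t x)).re ∂g.volumeMeasure) t := by
  have hpt : ∀ s x, HasDerivAt
      (fun s => Real.log (((h s).gram x x).det.re / (h₀.gram x x).det.re))
      (LinearMap.trace ℂ (E x) (A s x)).re s := by
    intro s x
    set e := trivializationAt (Fin r → ℂ) E x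
    have hx : x ∈ e.baseSet := mem_baseSet_trivializationAt _ _ x
    let L := (e.linearEquivAt ℂ x hx).symm
    have hL : ∀ v, e.symmL ℂ x v = L v := fun v => e.symmL_apply (R := ℂ) hx v
    let b := (Pi.basisFun ℂ (Fin r)).map L
    have hb : ∀ i, e.symmL ℂ x (Pi.single i 1) = b i := fun i => by
      rw [hL]; simp [b, Pi.basisFun_apply]
    have hder := hasDerivAt_det (M := fun s => (h s).gram x x)
      (A := LinearMap.toMatrix b b (A s x)) (t := s) (fun i j => by
        have h1 := hA s x (e.symmL ℂ x (Pi.single i 1)) (e.symmL ℂ x (Pi.single j 1))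
        refine HasDerivAt.congr_deriv (f := fun s => (h s).gram x x i j) h1 ?_
        rw [Matrix.mul_apply, hb j, ← b.sum_repr (A s x (b j)), core_sum_right]
        refine Finset.sum_congr rfl fun k _ => ?_
        rw [core_smul_right, LinearMap.toMatrix_apply, mul_comm, ← hb k]
        rfl)
    rw [← LinearMap.trace_eq_matrix_trace] at hder
    have hre : HasDerivAt (fun s => ((h s).gram x x).det.re)
        (((h s).gram x x).det.re * (LinearMap.trace ℂ (E x) (A s x)).re) s := by
      have h2 := Complex.reCLM.hasFDerivAt.comp_hasDerivAt s hder
      have him : ((h s).gram x x).det.im = 0 := (h s).gram_det_im hx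
      refine HasDerivAt.congr_deriv (f := fun s => ((h s).gram x x).det.re) h2 ?_
      change (_ * _ : ℂ).re = _
      rw [Complex.mul_re, him, zero_mul, sub_zero]
    have hp := (h s).gram_det_pos hx
    have hp₀ := h₀.gram_det_pos hx
    have h3 := (hre.div_const (h₀.gram x x).det.re).log (div_pos hp hp₀).ne'
    convert h3 using 1
    field_simp
  obtain ⟨C, hC⟩ := ((isCompact_closedBall t 1).prod (isCompact_univ (X := X))).exists_bound_of_continuousOn
    hc.continuousOn
  exact (hasDerivAt_integral_of_dominated_loc_of_deriv_le (bound := fun _ => C)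
    (F := fun s x => Real.log (((h s).gram x x).det.re / (h₀.gram x x).det.re))
    (F' := fun s x => (LinearMap.trace ℂ (E x) (A s x)).re)
    (Metric.ball_mem_nhds t one_pos)
    (Eventually.of_forall fun s => (continuous_log_gram_ratio (h s) h₀).aestronglyMeasurable)
    ((continuous_log_gram_ratio (h t) h₀).integrable_of_hasCompactSupport
      (HasCompactSupport.of_compactSpace _))
    (Complex.continuous_re.comp (hc.comp (Continuous.prodMk_right t))).aestronglyMeasurable
    (ae_of_all _ fun x s hs => (Complex.abs_re_le_norm _).trans
      (hC (s, x) ⟨Metric.ball_subset_closedBall hs, mem_univ x⟩))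
    (integrable_const C) (ae_of_all _ fun x s _ => hpt s x)).2
end Variation

end BalancedMetric

end

/-!
The functional `Z̃` is convex along the geodesics of the space of Hermitian inner products on
`H⁰(X, E)`, and the operator `T` decreases it. Both facts reduce to elementary inequalities on the
eigenvalues of one inner product relative to another, because any two inner products can be
diagonalized simultaneously (`exists_simultaneous_basis`).

*Convexity.* Let `s` be an `H`-orthonormal basis with `H'(sᵢ, sⱼ) = e^{-lᵢ} δᵢⱼ`. On the fibre at `x`
let `v` be an eigenbasis of `FS(H')⁻¹ FS(H)`, orthonormal for `FS(H)`. The eigenvalue belonging to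
`v_a` is `∑ᵢ e^{lᵢ} |⟨sᵢ(x), v_a⟩|²`, where the weights `|⟨sᵢ(x), v_a⟩|²` have sum `1`. Jensen's
inequality, summed over `a`, gives `log det (FS(H')⁻¹ FS(H)) ≥ ∑ᵢ lᵢ |sᵢ(x)|²`
(`sum_mul_le_logDet_sub`). Integration over `X` yields (`Ztilde_add_le`)
`Z̃(H') ≥ Z̃(H) + (r V / N) ∑ᵢ lᵢ (T(H)(sᵢ, sᵢ) - 1)`.
The trace of `T(H)` with respect to `H` is `N` (`sum_re_inner_T`), so only the differences of the
`lᵢ` matter: if they are at most `log C` and `T(H)` is `η`-close to `H`, then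
`Z̃(H') ≥ Z̃(H) - r V η log C` (`Ztilde_sub_le`).

*Monotonicity.* The bound `log det A ≤ tr A - r` on the fibres gives `Z(T(H)) ≤ Z(H)` (`Z_T_le`), and
the arithmetic-geometric mean inequality for the eigenvalues of `T(H)` relative to `H` gives
`log det T(H) ≤ log det H` (`logDet_le_of_trace`). The second inequality is stable: if its two sides
are close, then `T(H)` is close to `H` (`abs_inner_sub_le_of_trace`).

*Conclusion.* Boundedness in the sense of Sano bounds the quotients of the eigenvalues of a fixed
inner product relative to `H_k`, uniformly in `k` (`IsBoundedFamily.exists_ratio_bound`). The convexity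
estimate based at `H₀` then shows that the decreasing sequence `Z̃(H_k)` is bounded below, hence
convergent. Its decrements tend to `0`, so do those of `log det H_k`, and `T(H_k)` is
asymptotically close to `H_k`. The convexity estimate based at `H_k` now gives
`Z̃(H) ≥ lim Z̃(H_k)` for every `H`. No limit of the sequence `H_k` itself is needed.
-/

open Set Filter Bundle MeasureTheory
open scoped Manifold ContDiff Topology ComplexConjugate

set_option linter.unusedSectionVars false

noncomputable section
namespace BalancedMetric

variable {n r : ℕ} {X : Type*} [TopologicalSpace X] [ChartedSpace (Fin n → ℂ) X]

/-! ### Simultaneous diagonalization -/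

section LinearAlgebra
variable {W : Type*} [AddCommGroup W] [Module ℂ W]

theorem core_self_im (c : InnerProductSpace.Core ℂ W) (v : W) : (c.inner v v).im = 0 :=
  Complex.conj_eq_iff_im.1 (c.conj_inner_symm v v)

theorem core_self_pos (c : InnerProductSpace.Core ℂ W) {v : W} (hv : v ≠ 0) :
    0 < (c.inner v v).re :=
  lt_of_le_of_ne (c.re_inner_nonneg v) fun h =>
    hv (c.definite v (Complex.ext h.symm (core_self_im c v)))

/-- The family `s` is orthogonal for `H`, with squared norms `τ`. -/
def IsOrthogonalFor {ι : Type*} [DecidableEq ι] (H : InnerProductSpace.Core ℂ W) (τ : ι → ℝ)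
    (s : ι → W) : Prop :=
  ∀ i j, H.inner (s i) (s j) = if i = j then (τ i : ℂ) else 0

theorem IsOrthonormalFor.isOrthogonalFor {ι : Type*} [DecidableEq ι]
    {H : InnerProductSpace.Core ℂ W} {s : ι → W} (hs : IsOrthonormalFor H s) :
    IsOrthogonalFor H (fun _ => 1) s := fun i j => by simpa using hs i j

/-- Two Hermitian inner products can be diagonalized simultaneously. -/
theorem exists_simultaneous_basis [FiniteDimensional ℂ W] {m : ℕ} (hm : Module.finrank ℂ W = m)
    (H H' : InnerProductSpace.Core ℂ W) :
    ∃ (s : Module.Basis (Fin m) ℂ W) (τ : Fin m → ℝ), IsOrthonormalFor H s ∧ (∀ i, 0 < τ i) ∧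
      IsOrthogonalFor H' τ s := by
  obtain ⟨e, he⟩ := exists_orthonormal_basis H
  -- the operator `A` with `H(v, A w) = H'(v, w)`
  let A : W →ₗ[ℂ] W :=
    { toFun := fun w => ∑ i, H'.inner (e i) w • e i
      map_add' := fun v w => by simp only [core_add_right, add_smul, Finset.sum_add_distrib]
      map_smul' := fun a w => by
        simp only [core_smul_right, mul_smul, Finset.smul_sum, RingHom.id_apply] }
  have hA : ∀ v w, H.inner v (A w) = H'.inner v w := by
    intro v w
    conv_rhs => rw [he.expand v]
    change H.inner v (∑ i, H'.inner (e i) w • e i) = _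
    simp only [core_sum_right, core_smul_right, core_sum_left, H'.smul_left, H.conj_inner_symm]
    exact Finset.sum_congr rfl fun i _ => mul_comm _ _
  let := H.toNormedAddCommGroup
  let := InnerProductSpace.ofCore H.toCore
  have hsymm : A.IsSymmetric := by
    intro v w
    change H.inner (A v) w = H.inner v (A w)
    rw [hA, ← H.conj_inner_symm, hA, H'.conj_inner_symm]
  have hon : IsOrthonormalFor H (hsymm.eigenvectorBasis hm).toBasis := by
    intro i j
    have := orthonormal_iff_ite.1 (hsymm.eigenvectorBasis hm).orthonormal i j
    rw [OrthonormalBasis.coe_toBasis]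
    exact this
  have hor : IsOrthogonalFor H' (hsymm.eigenvalues hm) (hsymm.eigenvectorBasis hm).toBasis := by
    intro i j
    rw [← hA, OrthonormalBasis.coe_toBasis, hsymm.apply_eigenvectorBasis hm j,
      ← OrthonormalBasis.coe_toBasis, core_smul_right, hon i j]
    split_ifs with h
    · subst h; simp
    · simp
  refine ⟨(hsymm.eigenvectorBasis hm).toBasis, hsymm.eigenvalues hm, hon, fun i => ?_, hor⟩
  have h1 := core_self_pos H' ((hsymm.eigenvectorBasis hm).toBasis.ne_zero i)
  rw [hor i i, if_pos rfl, Complex.ofReal_re] at h1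
  exact h1

section Expand
variable {ι : Type*} [DecidableEq ι] [Fintype ι] {H H' : InnerProductSpace.Core ℂ W}
  {s : Module.Basis ι ℂ W} {τ : ι → ℝ}

theorem IsOrthogonalFor.inner_eq (hs : IsOrthonormalFor H s) (hs' : IsOrthogonalFor H' τ s)
    (v : W) (j : ι) : H'.inner v (s j) = τ j * H.inner v (s j) := by
  have h : ∀ K : InnerProductSpace.Core ℂ W, K.inner v (s j) =
      ∑ i, conj (H.inner (s i) v) * K.inner (s i) (s j) := by
    intro K
    conv_lhs => rw [hs.expand v]
    simp only [core_sum_left, K.smul_left]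
  rw [h H', h H]
  simp only [hs' _ _, hs _ _]
  simp [mul_comm]

theorem IsOrthogonalFor.re_inner_self (hs : IsOrthonormalFor H s) (hs' : IsOrthogonalFor H' τ s)
    (v : W) : (H'.inner v v).re = ∑ i, τ i * Complex.normSq (H.inner v (s i)) := by
  have h : H'.inner v v = ∑ i, ((τ i * Complex.normSq (H.inner v (s i)) : ℝ) : ℂ) := by
    conv_lhs => arg 3; rw [hs.expand v]
    rw [core_sum_right]
    refine Finset.sum_congr rfl fun i _ => ?_
    rw [core_smul_right, hs'.inner_eq hs, ← H.conj_inner_symm]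
    push_cast
    rw [Complex.normSq_eq_conj_mul_self]
    ring
  rw [h, ← Complex.ofReal_sum, Complex.ofReal_re]

theorem IsOrthonormalFor.re_inner_self (hs : IsOrthonormalFor H s) (v : W) :
    (H.inner v v).re = ∑ i, Complex.normSq (H.inner v (s i)) := by
  simpa using hs.isOrthogonalFor.re_inner_self hs v

end Expand

/-- The determinants of the Gram matrices of two inner products in any basis differ by the product
of their relative eigenvalues. -/
theorem IsOrthogonalFor.log_det_sub {m : ℕ} {H H' : InnerProductSpace.Core ℂ W}
    {s : Module.Basis (Fin m) ℂ W} {τ : Fin m → ℝ} (hs : IsOrthonormalFor H s)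
    (hτ : ∀ i, 0 < τ i) (hs' : IsOrthogonalFor H' τ s) (θ : Module.Basis (Fin m) ℂ W) :
    logDet θ H' - logDet θ H = ∑ i, Real.log (τ i) := by
  let B : (Fin m → ℂ) →ₗ[ℂ] (Fin m → ℂ) :=
    (θ.equivFun.symm.trans s.equivFun).toLinearMap
  have hB : ∀ i, s.equivFun.symm (B (Pi.single i 1)) = θ i := by
    intro i
    simp [B]
  have hS : ∀ i, s.equivFun.symm (Pi.single i (1 : ℂ)) = s i := by
    intro i
    simp
  have hne : Complex.normSq (LinearMap.det B) ≠ 0 := by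
    rw [Ne, Complex.normSq_eq_zero]
    exact (LinearEquiv.isUnit_det' (θ.equivFun.symm.trans s.equivFun)).ne_zero
  have key : ∀ (K : InnerProductSpace.Core ℂ W) (σ : Fin m → ℝ), (∀ i, 0 < σ i) →
      IsOrthogonalFor K σ s →
      logDet θ K = Real.log (Complex.normSq (LinearMap.det B)) + ∑ i, Real.log (σ i) := by
    intro K σ hσ hK
    have h := core_det_comp K s.equivFun.symm.toLinearMap B
    simp only [LinearEquiv.coe_coe, hB, hS] at h
    have hd : (Matrix.of fun a b => K.inner (s a) (s b)) =
        Matrix.diagonal fun i => (σ i : ℂ) := by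
      ext i j
      rw [Matrix.of_apply, hK i j, Matrix.diagonal_apply]
    rw [logDet, h, hd, Matrix.det_diagonal, ← Complex.ofReal_prod, Complex.ofReal_re,
      Real.log_mul hne (Finset.prod_pos fun i _ => hσ i).ne',
      Real.log_prod fun i _ => (hσ i).ne']
  rw [key H' τ hτ hs', key H _ (fun _ => one_pos) hs.isOrthogonalFor]
  simp

theorem IsOrthogonalFor.exists_orthonormal_rescaling {V ι : Type*} [AddCommGroup V] [Module ℂ V]
    [DecidableEq ι] {H : InnerProductSpace.Core ℂ V} {s : Module.Basis ι ℂ V} {l : ι → ℝ}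
    (hs : IsOrthogonalFor H (fun i => Real.exp (-l i)) s) :
    ∃ s' : Module.Basis ι ℂ V, IsOrthonormalFor H s' ∧
      ∀ i, s' i = (Real.exp (l i / 2) : ℂ) • s i := by
  have hu : ∀ i, IsUnit (Real.exp (l i / 2) : ℂ) := fun i =>
    isUnit_iff_ne_zero.2 (Complex.ofReal_ne_zero.2 (Real.exp_pos _).ne')
  refine ⟨s.isUnitSMul hu, fun i j => ?_, fun i => s.isUnitSMul_apply hu i⟩
  rw [s.isUnitSMul_apply, s.isUnitSMul_apply, H.smul_left, core_smul_right, hs i j]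
  split_ifs with h
  · subst h
    rw [Complex.conj_ofReal, ← Complex.ofReal_mul, ← Complex.ofReal_mul, ← Real.exp_add,
      ← Real.exp_add]
    have : l i / 2 + (l i / 2 + -l i) = 0 := by ring
    simp [this]
  · simp

end LinearAlgebra

/-! ### Parseval frames and determinants -/

section Frames
variable {W ι : Type*} [AddCommGroup W] [Module ℂ W] [Fintype ι]

/-- If `u` is a Parseval frame for `c'` and `v` is a `c`-orthonormal basis diagonalizing `c'`, then
the `c`-lengths of the components of `u` along `v` sum to the eigenvalues of `c'⁻¹ c`. -/
theorem sum_normSq_parseval {κ : Type*} [Fintype κ] [DecidableEq κ]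
    {c c' : InnerProductSpace.Core ℂ W} {u : ι → W}
    (hu : ∀ w, ∑ i, c'.inner (u i) w • u i = w) {v : Module.Basis κ ℂ W} {τ : κ → ℝ}
    (hv : IsOrthonormalFor c v) (hτ : ∀ a, 0 < τ a) (hv' : IsOrthogonalFor c' τ v) (a : κ) :
    ∑ i, Complex.normSq (c.inner (u i) (v a)) = (τ a)⁻¹ := by
  have h1 : c'.inner (v a) (v a) =
      ((τ a ^ 2 * ∑ i, Complex.normSq (c.inner (u i) (v a)) : ℝ) : ℂ) := by
    conv_lhs => arg 3; rw [← hu (v a)]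
    rw [core_sum_right]
    push_cast
    rw [Finset.mul_sum]
    refine Finset.sum_congr rfl fun i _ => ?_
    rw [core_smul_right, ← c'.conj_inner_symm (v a), hv'.inner_eq hv,
      Complex.normSq_eq_conj_mul_self, map_mul, Complex.conj_ofReal]
    ring
  rw [hv' a a, if_pos rfl, Complex.ofReal_inj] at h1
  have := (hτ a).ne'
  field_simp
  have h2 : τ a * ((∑ i, Complex.normSq (c.inner (u i) (v a))) * τ a) = τ a * 1 := by
    linear_combination -h1
  exact mul_left_cancel₀ this h2

/-- The bound `log det A ≤ tr A - r` for `A = c'⁻¹ c`, whose trace is `∑ i, c(uᵢ, uᵢ)` for any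
Parseval frame `u` of `c'`. -/
theorem logDet_sub_le_of_parseval {m : ℕ} (θ : Module.Basis (Fin m) ℂ W)
    {c c' : InnerProductSpace.Core ℂ W} {u : ι → W}
    (hu : ∀ w, ∑ i, c'.inner (u i) w • u i = w) :
    logDet θ c - logDet θ c' ≤ ∑ i, (c.inner (u i) (u i)).re - m := by
  have := Module.Finite.of_basis θ
  obtain ⟨v, τ, hv, hτ, hv'⟩ := exists_simultaneous_basis
    ((Module.finrank_eq_card_basis θ).trans (Fintype.card_fin m)) c c'
  have h1 := hv'.log_det_sub hv hτ θ
  have h2 : ∑ i, (c.inner (u i) (u i)).re = ∑ a, (τ a)⁻¹ := by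
    simp only [hv.re_inner_self]
    rw [Finset.sum_comm]
    exact Finset.sum_congr rfl fun a _ => sum_normSq_parseval hu hv hτ hv' a
  have h3 : ∑ a, Real.log (τ a)⁻¹ ≤ ∑ a, ((τ a)⁻¹ - 1) :=
    Finset.sum_le_sum fun a _ => Real.log_le_sub_one_of_pos (inv_pos.2 (hτ a))
  simp only [Real.log_inv, Finset.sum_neg_distrib, Finset.sum_sub_distrib, Finset.sum_const,
    Finset.card_univ, Fintype.card_fin, nsmul_eq_mul, mul_one] at h3
  rw [h2]
  linarith

/-- If `u` is a Parseval frame for `c` and `(e^{lᵢ/2} uᵢ)` is one for `c'`, then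
`log det (c'⁻¹ c) ≥ ∑ i, lᵢ c(uᵢ, uᵢ)`. In an eigenbasis of `c'⁻¹ c` this is Jensen's inequality
for the logarithm, one eigenvector at a time. -/
theorem sum_mul_le_logDet_sub {m : ℕ} (θ : Module.Basis (Fin m) ℂ W)
    {c c' : InnerProductSpace.Core ℂ W} {u : ι → W} (l : ι → ℝ)
    (hu : ∀ w, ∑ i, c.inner (u i) w • u i = w)
    (hu' : ∀ w, ∑ i, c'.inner ((Real.exp (l i / 2) : ℂ) • u i) w •
      ((Real.exp (l i / 2) : ℂ) • u i) = w) :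
    ∑ i, l i * (c.inner (u i) (u i)).re ≤ logDet θ c - logDet θ c' := by
  have := Module.Finite.of_basis θ
  obtain ⟨v, τ, hv, hτ, hv'⟩ := exists_simultaneous_basis
    ((Module.finrank_eq_card_basis θ).trans (Fintype.card_fin m)) c c'
  have h1 := hv'.log_det_sub hv hτ θ
  have hJ : ∀ a, ∑ i, Complex.normSq (c.inner (u i) (v a)) * l i ≤ -Real.log (τ a) := by
    intro a
    have hw := sum_normSq_parseval hu hv (fun _ => one_pos) hv.isOrthogonalFor a
    have hw' := sum_normSq_parseval hu' hv hτ hv' a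
    have he : ∀ i, Complex.normSq (c.inner ((Real.exp (l i / 2) : ℂ) • u i) (v a)) =
        Complex.normSq (c.inner (u i) (v a)) * Real.exp (l i) := by
      intro i
      rw [c.smul_left, Complex.conj_ofReal, Complex.normSq_mul, Complex.normSq_ofReal,
        ← Real.exp_add, add_halves, mul_comm]
    simp only [he] at hw'
    have hJ := convexOn_exp.map_sum_le (t := Finset.univ)
      (w := fun i => Complex.normSq (c.inner (u i) (v a))) (p := l)
      (fun i _ => Complex.normSq_nonneg _) (by rw [hw, inv_one]) (fun i _ => mem_univ _)
    simp only [smul_eq_mul, hw'] at hJ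
    rw [← Real.log_inv]
    exact (Real.le_log_iff_exp_le (inv_pos.2 (hτ a))).2 hJ
  calc ∑ i, l i * (c.inner (u i) (u i)).re
      = ∑ a, ∑ i, Complex.normSq (c.inner (u i) (v a)) * l i := by
        rw [Finset.sum_comm]
        refine Finset.sum_congr rfl fun i _ => ?_
        rw [hv.re_inner_self, ← Finset.sum_mul, mul_comm]
    _ ≤ ∑ a, -Real.log (τ a) := Finset.sum_le_sum fun a _ => hJ a
    _ = logDet θ c - logDet θ c' := by rw [Finset.sum_neg_distrib]; linarith

end Frames

/-! ### The energy functional in terms of fibrewise determinants -/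

section Energy
variable {E : X → Type*}
  [TopologicalSpace (TotalSpace (Fin r → ℂ) E)] [∀ x, TopologicalSpace (E x)]
  [∀ x, AddCommGroup (E x)] [∀ x, Module ℂ (E x)]
  [FiberBundle (Fin r → ℂ) E] [VectorBundle ℂ (Fin r → ℂ) E]

variable (r E) in
/-- The basis of the fibre `Eₓ` given by the preferred trivialization at `x`. -/
def fibreBasis (x : X) : Module.Basis (Fin r) ℂ (E x) :=
  (Pi.basisFun ℂ (Fin r)).map ((trivializationAt (Fin r → ℂ) E x).linearEquivAt ℂ x
    (mem_baseSet_trivializationAt _ _ x)).symm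

theorem log_gram_ratio (h h₀ : HermitianMetric n r E) (x : X) :
    Real.log ((h.gram x x).det.re / (h₀.gram x x).det.re) =
      logDet (fibreBasis r E x) (h.form x) - logDet (fibreBasis r E x) (h₀.form x) := by
  have hx := mem_baseSet_trivializationAt (Fin r → ℂ) E x
  have hb : ∀ i, (trivializationAt (Fin r → ℂ) E x).symmL ℂ x (Pi.single i 1) =
      fibreBasis r E x i := fun i => by
    rw [Trivialization.symmL_apply (R := ℂ) _ hx]
    simp [fibreBasis, Pi.basisFun_apply]
  have hg : ∀ k : HermitianMetric n r E, Real.log (k.gram x x).det.re =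
      logDet (fibreBasis r E x) (k.form x) := fun k => by
    simp only [HermitianMetric.gram, logDet, hb]
  rw [Real.log_div (h.gram_det_pos hx).ne' (h₀.gram_det_pos hx).ne', hg, hg]

variable [CompactSpace X] [T2Space X] [MeasurableSpace X] [BorelSpace X]
  [IsManifold 𝓘(ℂ, Fin n → ℂ) ω X]

theorem integrable_log_gram_ratio (g : KaehlerMetric n X) (h h₀ : HermitianMetric n r E) :
    Integrable (fun x => Real.log ((h.gram x x).det.re / (h₀.gram x x).det.re))
      g.volumeMeasure :=
  (continuous_log_gram_ratio h h₀).integrable_of_hasCompactSupport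
    (HasCompactSupport.of_compactSpace _)

theorem energy_sub (g : KaehlerMetric n X) (h₀ h h' : HermitianMetric n r E) :
    energy g h₀ h - energy g h₀ h' =
      ∫ x, Real.log ((h.gram x x).det.re / (h'.gram x x).det.re) ∂g.volumeMeasure := by
  rw [energy, energy, ← integral_sub (integrable_log_gram_ratio g h h₀)
    (integrable_log_gram_ratio g h' h₀)]
  simp only [log_gram_ratio, sub_sub_sub_cancel_right]

end Energy

/-! ### The Fubini–Study metric and the functionals along `T` -/

section TOperator
variable {E : X → Type*}
  [TopologicalSpace (TotalSpace (Fin r → ℂ) E)] [∀ x, TopologicalSpace (E x)]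
  [∀ x, AddCommGroup (E x)] [∀ x, Module ℂ (E x)]
  [FiberBundle (Fin r → ℂ) E] [VectorBundle ℂ (Fin r → ℂ) E]
  [CompactSpace X] [T2Space X] [MeasurableSpace X] [BorelSpace X]
  [IsManifold 𝓘(ℂ, Fin n → ℂ) ω X] [ContMDiffVectorBundle ω (Fin r → ℂ) E 𝓘(ℂ, Fin n → ℂ)]

theorem rank_pos_of_finrank_pos (hN : 0 < Module.finrank ℂ (HolSection n r E)) : 0 < r := by
  obtain ⟨s, hs⟩ := Module.finrank_pos_iff_exists_ne_zero.1 hN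
  refine Nat.pos_of_ne_zero fun h => hs (ContMDiffSection.ext fun x => ?_)
  subst h
  exact ((trivializationAt (Fin 0 → ℂ) E x).linearEquivAt ℂ x
    (mem_baseSet_trivializationAt _ _ x)).injective (Subsingleton.elim _ _)

theorem volume_pos_of_finrank_pos (g : KaehlerMetric n X)
    (hN : 0 < Module.finrank ℂ (HolSection n r E)) : 0 < g.volumeMeasure.real univ := by
  obtain ⟨s, hs⟩ := Module.finrank_pos_iff_exists_ne_zero.1 hN
  have : Nonempty X := by
    by_contra hX
    rw [not_nonempty_iff] at hX
    exact hs (ContMDiffSection.ext fun x => hX.elim x)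
  rw [measureReal_def]
  exact ENNReal.toReal_pos (isOpen_univ.measure_pos _ univ_nonempty).ne' (measure_ne_top _ _)

theorem integrable_re_inner (g : KaehlerMetric n X) (h : HermitianMetric n r E)
    (s : HolSection n r E) :
    Integrable (fun x => ((h.form x).inner (s x) (s x)).re) g.volumeMeasure :=
  (integrable_inner g h s s).re

theorem integral_re_inner (g : KaehlerMetric n X) (hN : 0 < Module.finrank ℂ (HolSection n r E))
    (h : HermitianMetric n r E) (s : HolSection n r E) :
    ∫ x, ((h.form x).inner (s x) (s x)).re ∂g.volumeMeasure =
      r * g.volumeMeasure.real univ / Module.finrank ℂ (HolSection n r E) *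
        ((Hilb g h).inner s s).re := by
  have hr : (0 : ℝ) < r := by exact_mod_cast rank_pos_of_finrank_pos hN
  have hV := volume_pos_of_finrank_pos g hN
  have hN' : (0 : ℝ) < Module.finrank ℂ (HolSection n r E) := by exact_mod_cast hN
  change _ = _ * (_ * _ : ℂ).re
  rw [Complex.re_ofReal_mul, re_integral_inner]
  field_simp

/-- Pointwise, `∑ i, |sᵢ|² = r` for the Fubini–Study metric and an orthonormal basis `s`. -/
theorem FS_sum_re_inner (hE : IsGloballyGenerated n r E)
    {H : InnerProductSpace.Core ℂ (HolSection n r E)}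
    {s : Module.Basis (Fin (Module.finrank ℂ (HolSection n r E))) ℂ (HolSection n r E)}
    (hs : IsOrthonormalFor H s) (x : X) :
    ∑ i, (((FS hE H).form x).inner (s i x) (s i x)).re = r := by
  have hf : Module.finrank ℂ (E x) = r :=
    (Module.finrank_eq_card_basis (fibreBasis r E x)).trans (Fintype.card_fin r)
  have := Module.Finite.of_basis (fibreBasis r E x)
  obtain ⟨v, τ, hv, -⟩ := exists_simultaneous_basis hf ((FS hE H).form x) ((FS hE H).form x)
  simp only [hv.re_inner_self]
  rw [Finset.sum_comm]
  simp only [sum_normSq_parseval (FS_spec hE H s hs x) hv (fun _ => one_pos) hv.isOrthogonalFor]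
  simp

/-- The trace of `T H` with respect to `H` is the dimension of `H⁰(X, E)`. -/
theorem sum_re_inner_T (g : KaehlerMetric n X) (hE : IsGloballyGenerated n r E)
    {H : InnerProductSpace.Core ℂ (HolSection n r E)}
    {s : Module.Basis (Fin (Module.finrank ℂ (HolSection n r E))) ℂ (HolSection n r E)}
    (hs : IsOrthonormalFor H s) :
    ∑ i, ((T g hE H).inner (s i) (s i)).re = Module.finrank ℂ (HolSection n r E) := by
  rcases Nat.eq_zero_or_pos (Module.finrank ℂ (HolSection n r E)) with h0 | hN
  · have : IsEmpty (Fin (Module.finrank ℂ (HolSection n r E))) := by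
      rw [h0]; infer_instance
    rw [Finset.univ_eq_empty, Finset.sum_empty, h0, Nat.cast_zero]
  have hr : (0 : ℝ) < r := by exact_mod_cast rank_pos_of_finrank_pos hN
  have hV := volume_pos_of_finrank_pos g hN
  have hN' : (0 : ℝ) < Module.finrank ℂ (HolSection n r E) := by exact_mod_cast hN
  have h1 : ∫ x, ∑ i, (((FS hE H).form x).inner (s i x) (s i x)).re ∂g.volumeMeasure =
      g.volumeMeasure.real univ * r := by
    simp only [FS_sum_re_inner hE hs, integral_const, smul_eq_mul]
  rw [integral_finsetSum _ fun i _ => integrable_re_inner g _ _] at h1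
  simp only [integral_re_inner g hN, ← Finset.mul_sum] at h1
  field_simp at h1
  linarith

/-- `Z` does not increase under `T`. -/
theorem Z_T_le (g : KaehlerMetric n X) (hE : IsGloballyGenerated n r E)
    (h₀ : HermitianMetric n r E) (hN : 0 < Module.finrank ℂ (HolSection n r E))
    (H : InnerProductSpace.Core ℂ (HolSection n r E)) :
    Z g hE h₀ (T g hE H) ≤ Z g hE h₀ H := by
  obtain ⟨s, hs⟩ := exists_orthonormal_basis (T g hE H)
  have hN' : (0 : ℝ) < Module.finrank ℂ (HolSection n r E) := by exact_mod_cast hN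
  have hi : Integrable (fun x => ∑ i, (((FS hE H).form x).inner (s i x) (s i x)).re)
      g.volumeMeasure := integrable_finsetSum _ fun i _ => integrable_re_inner g _ _
  have h1 : energy g h₀ (FS hE H) - energy g h₀ (FS hE (T g hE H)) ≤
      ∫ x, (∑ i, (((FS hE H).form x).inner (s i x) (s i x)).re - r) ∂g.volumeMeasure := by
    rw [energy_sub]
    refine integral_mono (integrable_log_gram_ratio g _ _) (hi.sub (integrable_const _))
      fun x => ?_
    change Real.log _ ≤ _
    rw [log_gram_ratio]
    exact logDet_sub_le_of_parseval _ (FS_spec hE (T g hE H) s hs x)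
  have h2 : ∫ x, (∑ i, (((FS hE H).form x).inner (s i x) (s i x)).re - r) ∂g.volumeMeasure = 0 := by
    rw [integral_sub hi (integrable_const _),
      integral_finsetSum _ fun i _ => integrable_re_inner g _ _]
    simp only [integral_re_inner g hN, ← Finset.mul_sum]
    have h3 : ∑ i, ((Hilb g (FS hE H)).inner (s i) (s i)).re =
        Module.finrank ℂ (HolSection n r E) := by
      simp only [hs _ _, if_true, Complex.one_re]
      simp
    rw [h3, integral_const, smul_eq_mul]
    field_simp
    ring
  rw [Z, Z]
  linarith

/-- The graph of `Z̃` along the geodesic `H_t(sᵢ, sⱼ) = e^{-t lᵢ} δᵢⱼ` from `H` to `H'` lies above its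
tangent at `t = 0`. -/
theorem Ztilde_add_le (g : KaehlerMetric n X) (hE : IsGloballyGenerated n r E)
    (h₀ : HermitianMetric n r E) (hN : 0 < Module.finrank ℂ (HolSection n r E))
    (θ : Module.Basis (Fin (Module.finrank ℂ (HolSection n r E))) ℂ (HolSection n r E))
    {H H' : InnerProductSpace.Core ℂ (HolSection n r E)}
    {s : Module.Basis (Fin (Module.finrank ℂ (HolSection n r E))) ℂ (HolSection n r E)}
    {l : Fin (Module.finrank ℂ (HolSection n r E)) → ℝ} (hs : IsOrthonormalFor H s)
    (hs' : IsOrthogonalFor H' (fun i => Real.exp (-l i)) s) :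
    Ztilde g hE h₀ θ H + r * g.volumeMeasure.real univ / Module.finrank ℂ (HolSection n r E) *
        ∑ i, l i * (((T g hE H).inner (s i) (s i)).re - 1) ≤ Ztilde g hE h₀ θ H' := by
  obtain ⟨s', hos', hs's⟩ := hs'.exists_orthonormal_rescaling
  have hi : ∀ i, Integrable (fun x => l i * (((FS hE H).form x).inner (s i x) (s i x)).re)
      g.volumeMeasure := fun i => (integrable_re_inner g _ _).const_mul _
  have h1 : ∫ x, (∑ i, l i * (((FS hE H).form x).inner (s i x) (s i x)).re) ∂g.volumeMeasure ≤
      energy g h₀ (FS hE H) - energy g h₀ (FS hE H') := by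
    rw [energy_sub]
    refine integral_mono (integrable_finsetSum _ fun i _ => hi i)
      (integrable_log_gram_ratio g _ _) fun x => ?_
    change _ ≤ Real.log _
    rw [log_gram_ratio]
    refine sum_mul_le_logDet_sub _ l (FS_spec hE H s hs x) fun w => ?_
    have h := FS_spec hE H' s' hos' x w
    simp only [hs's] at h
    exact h
  rw [integral_finsetSum _ fun i _ => hi i] at h1
  simp only [integral_const_mul, integral_re_inner g hN] at h1
  have h2 := hs'.log_det_sub hs (fun i => Real.exp_pos _) θ
  simp only [Real.log_exp, Finset.sum_neg_distrib] at h2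
  have h3 : logDet θ H' = logDet θ H - ∑ i, l i := by linarith
  rw [Ztilde, Ztilde, Z, Z, h3]
  have h4 : ∑ i, l i * (r * g.volumeMeasure.real univ / Module.finrank ℂ (HolSection n r E) *
      ((Hilb g (FS hE H)).inner (s i) (s i)).re) =
      r * g.volumeMeasure.real univ / Module.finrank ℂ (HolSection n r E) *
        ∑ i, l i * ((T g hE H).inner (s i) (s i)).re := by
    rw [Finset.mul_sum]
    exact Finset.sum_congr rfl fun i _ => mul_left_comm _ _ _
  rw [h4] at h1
  simp only [mul_sub, Finset.sum_sub_distrib, mul_one]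
  linarith

end TOperator

/-! ### Comparison of inner products and bounded families -/

section Comparison
variable {W : Type*} [AddCommGroup W] [Module ℂ W]

theorem sq_sqrt_sub_one_le {x : ℝ} (hx : 0 < x) : (√x - 1) ^ 2 ≤ x - 1 - Real.log x := by
  have h1 := Real.log_le_sub_one_of_pos (Real.sqrt_pos.2 hx)
  rw [Real.log_sqrt hx.le] at h1
  nlinarith [Real.sq_sqrt hx.le]

theorem abs_sub_one_le_of_log {x δ : ℝ} (hx : 0 < x) (h : x - 1 - Real.log x ≤ δ) :
    |x - 1| ≤ √δ * (2 + √δ) := by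
  have h1 : |√x - 1| ≤ √δ := Real.abs_le_sqrt ((sq_sqrt_sub_one_le hx).trans h)
  have h2 : x - 1 = (√x - 1) * (√x + 1) := by nlinarith [Real.sq_sqrt hx.le]
  have h3 : |√x + 1| ≤ 2 + √δ := by
    rw [abs_of_pos (by positivity)]
    linarith [(abs_le.1 h1).2]
  rw [h2, abs_mul]
  exact mul_le_mul h1 h3 (abs_nonneg _) (Real.sqrt_nonneg _)

/-- The inequality between the arithmetic and geometric means of the relative eigenvalues. -/
theorem logDet_le_of_trace {m : ℕ} {H K : InnerProductSpace.Core ℂ W}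
    (θ : Module.Basis (Fin m) ℂ W)
    (htr : ∀ s : Module.Basis (Fin m) ℂ W, IsOrthonormalFor H s →
      ∑ i, (K.inner (s i) (s i)).re = m) :
    logDet θ K ≤ logDet θ H := by
  have := Module.Finite.of_basis θ
  obtain ⟨s, τ, hs, hτ, hs'⟩ := exists_simultaneous_basis
    ((Module.finrank_eq_card_basis θ).trans (Fintype.card_fin m)) H K
  have h1 := hs'.log_det_sub hs hτ θ
  have h2 := htr s hs
  simp only [hs' _ _, if_true, Complex.ofReal_re] at h2
  have h3 : ∑ i, Real.log (τ i) ≤ ∑ i, (τ i - 1) :=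
    Finset.sum_le_sum fun i _ => Real.log_le_sub_one_of_pos (hτ i)
  rw [Finset.sum_sub_distrib, h2] at h3
  simp at h3
  linarith

/-- Stability of the arithmetic-geometric mean inequality: if `K` has trace `m` with respect to `H`
and its determinant is not much smaller than that of `H`, then `K` is close to `H`. -/
theorem abs_inner_sub_le_of_trace {m : ℕ} {H K : InnerProductSpace.Core ℂ W}
    (θ : Module.Basis (Fin m) ℂ W)
    (htr : ∀ s : Module.Basis (Fin m) ℂ W, IsOrthonormalFor H s →
      ∑ i, (K.inner (s i) (s i)).re = m)
    {δ : ℝ} (hδ : logDet θ H - logDet θ K ≤ δ) (v : W) :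
    |(K.inner v v).re - (H.inner v v).re| ≤ √δ * (2 + √δ) * (H.inner v v).re := by
  have := Module.Finite.of_basis θ
  obtain ⟨s, τ, hs, hτ, hs'⟩ := exists_simultaneous_basis
    ((Module.finrank_eq_card_basis θ).trans (Fintype.card_fin m)) H K
  have h1 := hs'.log_det_sub hs hτ θ
  have h2 := htr s hs
  simp only [hs' _ _, if_true, Complex.ofReal_re] at h2
  have h3 : ∑ i, (τ i - 1 - Real.log (τ i)) ≤ δ := by
    rw [Finset.sum_sub_distrib, Finset.sum_sub_distrib, h2]
    simp
    linarith
  have h4 : ∀ i, |τ i - 1| ≤ √δ * (2 + √δ) := fun i => by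
    refine abs_sub_one_le_of_log (hτ i) (le_trans ?_ h3)
    exact Finset.single_le_sum (f := fun i => τ i - 1 - Real.log (τ i))
      (fun j _ => by linarith [Real.log_le_sub_one_of_pos (hτ j)]) (Finset.mem_univ i)
  rw [hs'.re_inner_self hs, hs.re_inner_self, ← Finset.sum_sub_distrib, Finset.mul_sum]
  refine (Finset.abs_sum_le_sum_abs _ _).trans (Finset.sum_le_sum fun i _ => ?_)
  rw [← sub_one_mul, abs_mul, abs_of_nonneg (Complex.normSq_nonneg _)]
  exact mul_le_mul_of_nonneg_right (h4 i) (Complex.normSq_nonneg _)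

theorem exists_core_orthonormal {N : ℕ} (b : Module.Basis (Fin N) ℂ W) :
    ∃ B : InnerProductSpace.Core ℂ W, IsOrthonormalFor B b := by
  obtain ⟨B, hB, -⟩ := exists_unique_parseval b b.span_eq
  refine ⟨B, fun i j => ?_⟩
  have h := congrArg (fun w => b.repr w i) (hB (b j))
  simpa [Finsupp.single_apply, eq_comm] using h

theorem exists_core_bounds [FiniteDimensional ℂ W] (B H : InnerProductSpace.Core ℂ W) :
    ∃ a A : ℝ, 0 < a ∧ 0 < A ∧ ∀ v, a * (B.inner v v).re ≤ (H.inner v v).re ∧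
      (H.inner v v).re ≤ A * (B.inner v v).re := by
  have key : ∀ B H : InnerProductSpace.Core ℂ W, ∃ A : ℝ, 0 < A ∧ ∀ v,
      (H.inner v v).re ≤ A * (B.inner v v).re := by
    intro B H
    obtain ⟨s, τ, hs, hτ, hs'⟩ := exists_simultaneous_basis rfl B H
    have hnn : 0 ≤ ∑ i, τ i := Finset.sum_nonneg fun i _ => (hτ i).le
    refine ⟨1 + ∑ i, τ i, by positivity, fun v => ?_⟩
    rw [hs'.re_inner_self hs, hs.re_inner_self, Finset.mul_sum]
    refine Finset.sum_le_sum fun i _ => mul_le_mul_of_nonneg_right ?_ (Complex.normSq_nonneg _)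
    have := Finset.single_le_sum (fun j _ => (hτ j).le) (Finset.mem_univ i)
    linarith
  obtain ⟨A, hA, h⟩ := key B H
  obtain ⟨A', hA', h'⟩ := key H B
  refine ⟨A'⁻¹, A, inv_pos.2 hA', hA, fun v => ⟨?_, h v⟩⟩
  rw [inv_mul_le_iff₀ hA']
  exact h' v

/-- Bounds for the operator `ξ ↦ H ξ` amount to bounds for the quadratic form, as both say
that the eigenvalues of the matrix of `H` lie in a given interval. -/
theorem core_bounds_of_matrix_bounds {N : ℕ} {b : Module.Basis (Fin N) ℂ W}
    {B H : InnerProductSpace.Core ℂ W} (hB : IsOrthonormalFor B b) {p q : ℝ}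
    (h : ∀ ξ : EuclideanSpace ℂ (Fin N), p * ‖ξ‖ ≤
        ‖Matrix.toEuclideanCLM (𝕜 := ℂ) (Matrix.of fun i j => H.inner (b i) (b j)) ξ‖ ∧
      ‖Matrix.toEuclideanCLM (𝕜 := ℂ) (Matrix.of fun i j => H.inner (b i) (b j)) ξ‖ ≤ q * ‖ξ‖)
    (v : W) :
    p * (B.inner v v).re ≤ (H.inner v v).re ∧ (H.inner v v).re ≤ q * (B.inner v v).re := by
  have := Module.Finite.of_basis b
  obtain ⟨s, τ, hs, hτ, hs'⟩ := exists_simultaneous_basis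
    ((Module.finrank_eq_card_basis b).trans (Fintype.card_fin N)) B H
  have hb : ∀ i, p ≤ τ i ∧ τ i ≤ q := by
    intro i
    -- `ξ` is the coordinate vector of `s i`, an eigenvector of the matrix of `H`
    let ξ : EuclideanSpace ℂ (Fin N) := WithLp.toLp 2 fun j => B.inner (b j) (s i)
    have hξ : Matrix.toEuclideanCLM (𝕜 := ℂ) (Matrix.of fun i j => H.inner (b i) (b j)) ξ =
        (τ i : ℂ) • ξ := by
      ext j
      rw [Matrix.ofLp_toEuclideanCLM]
      change ∑ k, H.inner (b j) (b k) * B.inner (b k) (s i) = τ i * B.inner (b j) (s i)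
      rw [← hs'.inner_eq hs]
      conv_rhs => rw [hB.expand (s i)]
      simp only [core_sum_right, core_smul_right]
      exact Finset.sum_congr rfl fun k _ => mul_comm _ _
    have hξ0 : 0 < ‖ξ‖ := by
      refine norm_pos_iff.2 fun h0 => s.ne_zero i ?_
      rw [hB.expand (s i)]
      refine Finset.sum_eq_zero fun j _ => ?_
      have : B.inner (b j) (s i) = 0 := congrArg (fun η : EuclideanSpace ℂ (Fin N) => η j) h0
      rw [this, zero_smul]
    have h1 := h ξ
    rw [hξ, norm_smul, Complex.norm_of_nonneg (hτ i).le] at h1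
    exact ⟨le_of_mul_le_mul_right h1.1 hξ0, le_of_mul_le_mul_right h1.2 hξ0⟩
  rw [hs'.re_inner_self hs, hs.re_inner_self, Finset.mul_sum, Finset.mul_sum]
  exact ⟨Finset.sum_le_sum fun i _ => mul_le_mul_of_nonneg_right (hb i).1 (Complex.normSq_nonneg _),
    Finset.sum_le_sum fun i _ => mul_le_mul_of_nonneg_right (hb i).2 (Complex.normSq_nonneg _)⟩

/-- The relative eigenvalues of the members of a bounded family with respect to a fixed inner
product have uniformly bounded quotients. The scales `γ` cancel in this formulation. -/
theorem IsBoundedFamily.exists_ratio_bound {N : ℕ} {b : Module.Basis (Fin N) ℂ W}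
    {U : Set (InnerProductSpace.Core ℂ W)} (hU : IsBoundedFamily b U)
    (H' : InnerProductSpace.Core ℂ W) :
    ∃ C : ℝ, ∀ H ∈ U, ∀ v w, (H.inner v v).re * (H'.inner w w).re ≤
      C * ((H'.inner v v).re * (H.inner w w).re) := by
  have := Module.Finite.of_basis b
  obtain ⟨B, hB⟩ := exists_core_orthonormal b
  obtain ⟨a, A, ha, hA, hH'⟩ := exists_core_bounds B H'
  obtain ⟨R, hR, hU⟩ := hU
  have hR0 : 0 < R := one_pos.trans hR
  refine ⟨R ^ 2 * A / a, fun H hH v w => ?_⟩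
  obtain ⟨γ, hγ, h⟩ := hU H hH
  have hv := core_bounds_of_matrix_bounds hB h v
  have hw := core_bounds_of_matrix_bounds hB h w
  have hBv : 0 ≤ (B.inner v v).re := B.re_inner_nonneg v
  have hBw : 0 ≤ (B.inner w w).re := B.re_inner_nonneg w
  calc (H.inner v v).re * (H'.inner w w).re
      ≤ (γ * R * (B.inner v v).re) * (A * (B.inner w w).re) :=
        mul_le_mul hv.2 (hH' w).2 (H'.re_inner_nonneg w) (by positivity)
    _ = R ^ 2 * A / a * ((a * (B.inner v v).re) * (γ / R * (B.inner w w).re)) := by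
        field_simp
    _ ≤ R ^ 2 * A / a * ((H'.inner v v).re * (H.inner w w).re) :=
        mul_le_mul_of_nonneg_left
          (mul_le_mul (hH' v).1 hw.1 (by positivity) (H'.re_inner_nonneg v)) (by positivity)

end Comparison

/-! ### Iteration of `T` -/

section Iteration
variable {E : X → Type*}
  [TopologicalSpace (TotalSpace (Fin r → ℂ) E)] [∀ x, TopologicalSpace (E x)]
  [∀ x, AddCommGroup (E x)] [∀ x, Module ℂ (E x)]
  [FiberBundle (Fin r → ℂ) E] [VectorBundle ℂ (Fin r → ℂ) E]
  [CompactSpace X] [T2Space X] [MeasurableSpace X] [BorelSpace X]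
  [IsManifold 𝓘(ℂ, Fin n → ℂ) ω X] [ContMDiffVectorBundle ω (Fin r → ℂ) E 𝓘(ℂ, Fin n → ℂ)]

/-- An almost balanced `H` almost minimizes `Z̃`: if `T H` is `η`-close to `H` and the eigenvalues of
`H'` relative to `H` have quotients at most `C`, then `Z̃(H') ≥ Z̃(H) - r V η log C`. -/
theorem Ztilde_sub_le (g : KaehlerMetric n X) (hE : IsGloballyGenerated n r E)
    (h₀ : HermitianMetric n r E) (hN : 0 < Module.finrank ℂ (HolSection n r E))
    (θ : Module.Basis (Fin (Module.finrank ℂ (HolSection n r E))) ℂ (HolSection n r E))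
    {H H' : InnerProductSpace.Core ℂ (HolSection n r E)} {C η : ℝ}
    (hC : ∀ v w, (H.inner v v).re * (H'.inner w w).re ≤
      C * ((H'.inner v v).re * (H.inner w w).re))
    (hη : ∀ v, |((T g hE H).inner v v).re - (H.inner v v).re| ≤ η * (H.inner v v).re) :
    Ztilde g hE h₀ θ H - r * g.volumeMeasure.real univ * (Real.log C * η) ≤
      Ztilde g hE h₀ θ H' := by
  obtain ⟨s, τ, hs, hτ, hs'⟩ := exists_simultaneous_basis rfl H H'
  have hl : IsOrthogonalFor H' (fun i => Real.exp (-(-Real.log (τ i)))) s := by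
    simpa only [neg_neg, Real.exp_log (hτ _)] using hs'
  refine le_trans ?_ (Ztilde_add_le g hE h₀ hN θ hs hl)
  have hN' : (0 : ℝ) < Module.finrank ℂ (HolSection n r E) := by exact_mod_cast hN
  have hτC : ∀ i j, τ i ≤ C * τ j := by
    intro i j
    have h := hC (s j) (s i)
    simpa [hs _ _, hs' _ _] using h
  let i₀ : Fin (Module.finrank ℂ (HolSection n r E)) := ⟨0, hN⟩
  have hC0 : 0 < C := pos_of_mul_pos_left ((hτ i₀).trans_le (hτC i₀ i₀)) (hτ i₀).le
  have hlog : ∀ i j, Real.log (τ i) - Real.log (τ j) ≤ Real.log C := by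
    intro i j
    have h := Real.log_le_log (hτ i) (hτC i j)
    rw [Real.log_mul hC0.ne' (hτ j).ne'] at h
    linarith
  have ht : ∀ i, |((T g hE H).inner (s i) (s i)).re - 1| ≤ η := by
    intro i
    simpa [hs _ _] using hη (s i)
  -- the trace identity allows subtracting a constant from the logarithms of the eigenvalues
  have hsum : ∑ i, -Real.log (τ i) * (((T g hE H).inner (s i) (s i)).re - 1) =
      ∑ i, (Real.log (τ i₀) - Real.log (τ i)) * (((T g hE H).inner (s i) (s i)).re - 1) := by
    have h0 : ∑ i, Real.log (τ i₀) * (((T g hE H).inner (s i) (s i)).re - 1) = 0 := by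
      rw [← Finset.mul_sum, Finset.sum_sub_distrib, sum_re_inner_T g hE hs]
      simp
    simp only [sub_mul (Real.log (τ i₀)), Finset.sum_sub_distrib, h0, neg_mul,
      Finset.sum_neg_distrib, zero_sub]
  have hbound : -(Module.finrank ℂ (HolSection n r E) * (Real.log C * η)) ≤
      ∑ i, -Real.log (τ i) * (((T g hE H).inner (s i) (s i)).re - 1) := by
    rw [hsum]
    refine (abs_le.1 ((Finset.abs_sum_le_sum_abs _ _).trans
      ((Finset.sum_le_sum (g := fun _ => Real.log C * η) fun i _ => ?_).trans_eq ?_))).1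
    · rw [abs_mul]
      have h1 : |Real.log (τ i₀) - Real.log (τ i)| ≤ Real.log C :=
        abs_le.2 ⟨by linarith [hlog i i₀], hlog i₀ i⟩
      exact mul_le_mul h1 (ht i) (abs_nonneg _) ((abs_nonneg _).trans h1)
    · simp
  have h := mul_le_mul_of_nonneg_left hbound
    (show 0 ≤ r * g.volumeMeasure.real univ / Module.finrank ℂ (HolSection n r E) by positivity)
  have h' : r * g.volumeMeasure.real univ / Module.finrank ℂ (HolSection n r E) *
      -(Module.finrank ℂ (HolSection n r E) * (Real.log C * η)) =
      -(r * g.volumeMeasure.real univ * (Real.log C * η)) := by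
    field_simp
  rw [h'] at h
  linarith

/-- `Z̃` does not increase under `T`, and its decrease controls that of `log det`. -/
theorem Ztilde_T_le (g : KaehlerMetric n X) (hE : IsGloballyGenerated n r E)
    (h₀ : HermitianMetric n r E) (hN : 0 < Module.finrank ℂ (HolSection n r E))
    (θ : Module.Basis (Fin (Module.finrank ℂ (HolSection n r E))) ℂ (HolSection n r E))
    (H : InnerProductSpace.Core ℂ (HolSection n r E)) :
    r * g.volumeMeasure.real univ / Module.finrank ℂ (HolSection n r E) *
      (logDet θ H - logDet θ (T g hE H)) ≤
      Ztilde g hE h₀ θ H - Ztilde g hE h₀ θ (T g hE H) := by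
  have := Z_T_le g hE h₀ hN H
  rw [Ztilde, Ztilde]
  linarith

/-- If the iterates of `T` are bounded, then `Z̃` decreases along them to a lower bound of `Z̃`. -/
theorem exists_tendsto_Ztilde_iterate (g : KaehlerMetric n X) (hE : IsGloballyGenerated n r E)
    (h₀ : HermitianMetric n r E) (hN : 0 < Module.finrank ℂ (HolSection n r E))
    (θ b : Module.Basis (Fin (Module.finrank ℂ (HolSection n r E))) ℂ (HolSection n r E))
    (H₀ : InnerProductSpace.Core ℂ (HolSection n r E))
    (hbdd : IsBoundedFamily b (range fun k : ℕ => (T g hE)^[k] H₀)) :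
    ∃ L : ℝ, Tendsto (fun k : ℕ => Ztilde g hE h₀ θ ((T g hE)^[k] H₀)) atTop (𝓝 L) ∧
      (∀ k : ℕ, L ≤ Ztilde g hE h₀ θ ((T g hE)^[k] H₀)) ∧ ∀ H, L ≤ Ztilde g hE h₀ θ H := by
  have hN' : (0 : ℝ) < Module.finrank ℂ (HolSection n r E) := by exact_mod_cast hN
  have hr : (0 : ℝ) < r := by exact_mod_cast rank_pos_of_finrank_pos hN
  have hV := volume_pos_of_finrank_pos g hN
  set κ : ℝ := r * g.volumeMeasure.real univ / Module.finrank ℂ (HolSection n r E)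
  have hκ0 : 0 < κ := by positivity
  set z : ℕ → ℝ := fun k => Ztilde g hE h₀ θ ((T g hE)^[k] H₀)
  have hdet : ∀ H, logDet θ (T g hE H) ≤ logDet θ H := fun H =>
    logDet_le_of_trace θ fun s hs => sum_re_inner_T g hE hs
  have hstep : ∀ k, κ * (logDet θ ((T g hE)^[k] H₀) - logDet θ (T g hE ((T g hE)^[k] H₀))) ≤
      z k - z (k + 1) := by
    intro k
    have h := Ztilde_T_le g hE h₀ hN θ ((T g hE)^[k] H₀)
    rw [← Function.iterate_succ_apply' (T g hE) k H₀] at h ⊢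
    exact h
  have hanti : Antitone z := antitone_nat_of_succ_le fun k => by
    have h1 := hstep k
    have h2 := mul_nonneg hκ0.le (sub_nonneg.2 (hdet ((T g hE)^[k] H₀)))
    linarith
  have hclose : ∀ H : InnerProductSpace.Core ℂ (HolSection n r E), ∀ δ : ℝ,
      logDet θ H - logDet θ (T g hE H) ≤ δ → ∀ v,
      |((T g hE H).inner v v).re - (H.inner v v).re| ≤ √δ * (2 + √δ) * (H.inner v v).re :=
    fun H δ hδ => abs_inner_sub_le_of_trace θ (fun s hs => sum_re_inner_T g hE hs) hδ
  have hbelow : BddBelow (range z) := by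
    obtain ⟨C, hC⟩ := hbdd.exists_ratio_bound H₀
    set δ := logDet θ H₀ - logDet θ (T g hE H₀)
    refine ⟨Ztilde g hE h₀ θ H₀ - r * g.volumeMeasure.real univ *
      (Real.log C * (√δ * (2 + √δ))), ?_⟩
    rintro _ ⟨k, rfl⟩
    refine Ztilde_sub_le g hE h₀ hN θ (fun v w => ?_) (hclose H₀ δ le_rfl)
    have h := hC _ (mem_range_self k) w v
    linarith
  have hlim := tendsto_atTop_ciInf hanti hbelow
  refine ⟨⨅ k, z k, hlim, fun k => ciInf_le hbelow k, fun H => ?_⟩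
  obtain ⟨C, hC⟩ := hbdd.exists_ratio_bound H
  let δ : ℕ → ℝ := fun k => κ⁻¹ * (z k - z (k + 1))
  have hδ : Tendsto δ atTop (𝓝 0) := by
    simpa using (hlim.sub ((tendsto_add_atTop_iff_nat 1).2 hlim)).const_mul κ⁻¹
  have hη : Tendsto (fun k => √(δ k) * (2 + √(δ k))) atTop (𝓝 0) := by
    have h1 : Tendsto (fun k => √(δ k)) atTop (𝓝 0) := by simpa using hδ.sqrt
    simpa using h1.mul (h1.const_add 2)
  have hle : ∀ k, z k - r * g.volumeMeasure.real univ *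
      (Real.log C * (√(δ k) * (2 + √(δ k)))) ≤ Ztilde g hE h₀ θ H := by
    intro k
    refine Ztilde_sub_le g hE h₀ hN θ (hC _ (mem_range_self k)) (hclose _ _ ?_)
    rw [le_inv_mul_iff₀ hκ0]
    exact hstep k
  have hlim' := hlim.sub ((hη.const_mul (Real.log C)).const_mul (r * g.volumeMeasure.real univ))
  simp only [mul_zero, sub_zero] at hlim'
  exact le_of_tendsto' hlim' hle

end Iteration

end BalancedMetric

end

theorem mainTheorem4 {n r : ℕ} {X : Type*} [TopologicalSpace X] [CompactSpace X] [T2Space X]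
    [MeasurableSpace X] [BorelSpace X] [ChartedSpace (Fin n → ℂ) X]
    [IsManifold 𝓘(ℂ, Fin n → ℂ) ω X] {E : X → Type*}
    [TopologicalSpace (TotalSpace (Fin r → ℂ) E)] [∀ x, TopologicalSpace (E x)]
    [∀ x, AddCommGroup (E x)] [∀ x, Module ℂ (E x)]
    [FiberBundle (Fin r → ℂ) E] [VectorBundle ℂ (Fin r → ℂ) E]
    [ContMDiffVectorBundle ω (Fin r → ℂ) E 𝓘(ℂ, Fin n → ℂ)]
    (g : BalancedMetric.KaehlerMetric n X) (hE : BalancedMetric.IsGloballyGenerated n r E)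
    (h₀ : BalancedMetric.HermitianMetric n r E)
    (θ b : Module.Basis (Fin (Module.finrank ℂ (BalancedMetric.HolSection n r E))) ℂ
      (BalancedMetric.HolSection n r E))
    (H₀ : InnerProductSpace.Core ℂ (BalancedMetric.HolSection n r E))
    (hbdd : BalancedMetric.IsBoundedFamily b
      (range fun k : ℕ => (BalancedMetric.T g hE)^[k] H₀)) :
    (∀ (H : InnerProductSpace.Core ℂ (BalancedMetric.HolSection n r E)) (ε : ℝ), 0 < ε →
      ∀ᶠ k : ℕ in atTop, BalancedMetric.Ztilde g hE h₀ θ H >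
        BalancedMetric.Ztilde g hE h₀ θ ((BalancedMetric.T g hE)^[k] H₀) - ε) ∧
    BddBelow (range fun H => BalancedMetric.Ztilde g hE h₀ θ H) ∧
    Tendsto (fun k : ℕ => BalancedMetric.Ztilde g hE h₀ θ ((BalancedMetric.T g hE)^[k] H₀)) atTop
      (𝓝 (⨅ H, BalancedMetric.Ztilde g hE h₀ θ H)) := by
  rcases Nat.eq_zero_or_pos (Module.finrank ℂ (BalancedMetric.HolSection n r E)) with h0 | hN
  · -- without nonzero sections there is only one inner product
    have := Module.finrank_zero_iff.1 h0
    have hsub : Subsingleton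
        (InnerProductSpace.Core ℂ (BalancedMetric.HolSection n r E)) := by
      refine ⟨fun H H' => BalancedMetric.core_ext fun v w => ?_⟩
      have hz : ∀ K : InnerProductSpace.Core ℂ (BalancedMetric.HolSection n r E),
          K.inner v w = 0 := fun K => by
        rw [Subsingleton.elim w ((0 : ℂ) • w), BalancedMetric.core_smul_right, zero_mul]
      rw [hz, hz]
    have hconst : ∀ H, BalancedMetric.Ztilde g hE h₀ θ H = BalancedMetric.Ztilde g hE h₀ θ H₀ :=
      fun H => congrArg _ (Subsingleton.elim H H₀)
    have : Nonempty (InnerProductSpace.Core ℂ (BalancedMetric.HolSection n r E)) := ⟨H₀⟩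
    refine ⟨fun H ε hε => Eventually.of_forall fun k => ?_,
      ⟨BalancedMetric.Ztilde g hE h₀ θ H₀, ?_⟩, ?_⟩
    · rw [hconst, hconst ((BalancedMetric.T g hE)^[k] H₀)]
      linarith
    · rintro _ ⟨H, rfl⟩
      exact (hconst H).ge
    · simp only [hconst, ciInf_const]
      exact tendsto_const_nhds
  obtain ⟨L, hlim, hLk, hL⟩ :=
    BalancedMetric.exists_tendsto_Ztilde_iterate g hE h₀ hN θ b H₀ hbdd
  have hbelow : BddBelow (range fun H => BalancedMetric.Ztilde g hE h₀ θ H) :=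
    ⟨L, by rintro _ ⟨H, rfl⟩; exact hL H⟩
  have hinf : ⨅ H, BalancedMetric.Ztilde g hE h₀ θ H = L :=
    have : Nonempty (InnerProductSpace.Core ℂ (BalancedMetric.HolSection n r E)) := ⟨H₀⟩
    le_antisymm (ge_of_tendsto' hlim fun k => ciInf_le hbelow _) (le_ciInf hL)
  refine ⟨fun H ε hε => ?_, hbelow, by rwa [hinf]⟩
  filter_upwards [hlim.eventually (gt_mem_nhds (lt_add_of_pos_right L hε))] with k hk
  have := hL H
  linarith
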